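/- Let $S^2\subset\mathbb R^3$ be the unit sphere with its Lebesgue (surface) measure $dx$, of total mass $4\pi$, and geodesic distance $d(\cdot,\cdot)$, and let $P_\ell$ be the Legendre polynomial of degree $\ell$ normalised by $P_\ell(1)=1$. For integers $\ell\ge 1$, $q\ge 2$ and $1\le r\le q-1$ put $$\mathcal K_\ell(q;r)=\int_{(S^2)^4}P_\ell(\cos d(x_1,x_2))^{r}\,P_\ell(\cos d(x_2,x_3))^{q-r}\,P_\ell(\cos d(x_3,x_4))^{r}\,P_\ell(\cos d(x_1,x_4))^{q-r}\,dx_1dx_2dx_3dx_4 .$$ Then, as $\ell\to\infty$: 1. for $q=3$ and $r=1,2$: $\mathcal K_\ell(q;r)=O(\ell^{-5})$; 2. for $q=4$ and $r=1,2,3$: $\mathcal K_\ell(q;r)=O(\ell^{-4})$; 3. for $q=5,6$ and all $r=1,\dots,q-1$: $\mathcal K_\ell(q;r)=O(\ell^{-9/2}\log\ell)$; 4. for $q\ge 7$: $\mathcal K_\ell(q;1)=\mathcal K_\ell(q;q-1)=O(\ell^{-9/2})$, and $\mathcal K_\ell(q;r)=O(\ell^{-5})$ for $r=2,\dots,q-2$.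 Here $a_\ell=O(b_\ell)$ means that $|a_\ell|\le C\,b_\ell$ for all integers $\ell\ge 1$ (for all $\ell\ge 2$ in item 3, where $b_1=0$), and the constant $C$ is absolute: it does not depend on $\ell$, $q$ or $r$. -/

import Mathlib

open MeasureTheory

noncomputable section

/-- The Legendre polynomial `P_ℓ` of degree `ℓ`, normalised by `P_ℓ(1) = 1`, through the Rodrigues
formula `P_ℓ(t) = (2^ℓ ℓ!)⁻¹ (d/dt)^ℓ (t² - 1)^ℓ`. -/
def legendreP (ℓ : ℕ) : Polynomial ℝ :=
  Polynomial.C (1 / ((2 : ℝ) ^ ℓ * (Nat.factorial ℓ : ℝ))) *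
    Polynomial.derivative^[ℓ] ((Polynomial.X ^ 2 - 1) ^ ℓ)

/-- The unit sphere `S²` in Euclidean `ℝ³`. -/
abbrev S2 : Type := Metric.sphere (0 : EuclideanSpace ℝ (Fin 3)) 1

/-- The Lebesgue (surface) measure on `S²`, of total mass `4π`. -/
def sigmaS2 : Measure S2 := (volume : Measure (EuclideanSpace ℝ (Fin 3))).toSphere

/-- The spherical (geodesic) distance on `S²`: the angle between two unit vectors. -/
def sphDist (x y : S2) : ℝ :=
  InnerProductGeometry.angle (x : EuclideanSpace ℝ (Fin 3)) (y : EuclideanSpace ℝ (Fin 3))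

/-- The kernel `P_ℓ(cos d(x, y))`, the covariance of the Gaussian spherical harmonic of
degree `ℓ` on `S²`. -/
def legendreKernel (ℓ : ℕ) (x y : S2) : ℝ := (legendreP ℓ).eval (Real.cos (sphDist x y))

/-- The contraction integral `K_ℓ(q; r)` on `S²`, for `1 ≤ r ≤ q - 1`: the integral over `(S²)⁴` of
`P_ℓ(cos d(x₁,x₂))^r P_ℓ(cos d(x₂,x₃))^(q-r) P_ℓ(cos d(x₃,x₄))^r P_ℓ(cos d(x₁,x₄))^(q-r)`. -/
def contractionK (ℓ q r : ℕ) : ℝ :=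
  ∫ x : S2 × S2 × S2 × S2,
    legendreKernel ℓ x.1 x.2.1 ^ r * legendreKernel ℓ x.2.1 x.2.2.1 ^ (q - r) *
      legendreKernel ℓ x.2.2.1 x.2.2.2 ^ r * legendreKernel ℓ x.1 x.2.2.2 ^ (q - r)
    ∂(sigmaS2.prod (sigmaS2.prod (sigmaS2.prod sigmaS2)))

end

/-! The mean over the sphere of a zonal function is a multiple of its integral over [-1, 1]
(`integral_comp_sdot`), so everything reduces to integrals of powers of P_n. Bernstein's inequality
√(1-x²) P_n(x)² ≤ 2/n (`sqrt_mul_legendreP_sq_le`), which comes from a monotone Sonin function of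
the Legendre equation, gives ∫|P_n|^p = O(n^(-p/2)) for p < 4. The critical exponent p = 4, where a
logarithm would appear, is avoided: |P_n| ≤ 1 on [-1, 1], so powers from the fourth on are dominated
by |P_n|^(7/2).

The 4-cycle is then handled in three ways. For r = 1, P_n is an eigenfunction of convolution with
P_n^(q-1), so the contraction is exactly a constant times (∫P_n^q)² ∫P_n² (`contractionK_one_eq`).
This is O(n^(-9/2)) for q ≥ 4, and O(n^(-5)) for q = 3 thanks to the cancellation ∫P_n³ = O(n^(-2))
(`abs_integral_legendreP_cube_le`). For r ≥ 2, AM-GM on two opposite edges opens the cycle into a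
path, whose integral factors (`cycleIntegral_le_of_alternating`). For q = 4, r = 2, AM-GM over all
four edges loses nothing (`cycleIntegral_cube_le`). The symmetry r ↔ q - r covers the remaining
cases. Constants do not depend on q because exponents are first lowered to fixed values. -/

section LegendreBounds

open Polynomial

/-! ### Legendre polynomials: differential equation, parity, values at 1 and 0. -/

theorem iterate_derivative_succ_X_mul (f : ℝ[X]) (n : ℕ) :
    derivative^[n + 1] (X * f) = X * derivative^[n + 1] f + ((n : ℝ[X]) + 1) * derivative^[n] f := by
  rw [mul_comm, iterate_derivative_mul_X]
  simp [nsmul_eq_mul]; ring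

theorem iterate_derivative_comp_neg_X (p : ℝ[X]) (k : ℕ) :
    derivative^[k] (p.comp (-X)) = (-1) ^ k * (derivative^[k] p).comp (-X) := by
  induction k generalizing p with
  | zero => simp
  | succ k ih =>
    rw [Function.iterate_succ_apply, derivative_comp, Function.iterate_succ_apply]
    simp only [derivative_neg, derivative_X, neg_mul, one_mul, iterate_derivative_neg, ih]
    ring

/-- The Legendre differential equation. -/
theorem legendreP_ode (n : ℕ) :
    (1 - X ^ 2) * derivative (derivative (legendreP n)) =
      2 * X * derivative (legendreP n) - (n : ℝ[X]) * ((n : ℝ[X]) + 1) * legendreP n := by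
  set w : ℝ[X] := (X ^ 2 - 1) ^ n with hw
  -- w solves the first-order equation (X² - 1) w' = 2n X w; differentiating it n + 1 times by
  -- Leibniz gives the Legendre equation for the n-th derivative of w.
  have h0 : X * (X * derivative w) - derivative w = 2 * (n : ℝ[X]) * (X * w) := by
    rw [hw]
    rcases n with _ | n
    · simp
    · simp only [derivative_pow, derivative_sub, derivative_one]
      simp [← C_ofNat]
      simp only [map_ofNat]
      ring
  have h1 := congrArg (derivative^[n + 1]) h0
  have e3 : derivative^[n + 1] (2 * (n : ℝ[X]) * (X * w)) =
      2 * (n : ℝ[X]) * derivative^[n + 1] (X * w) := by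
    have : (2 * (n : ℝ[X])) = ((2 * n : ℕ) : ℝ[X]) := by push_cast; ring
    rw [this, iterate_derivative_natCast_mul]
  have d1 : ∀ k, derivative^[k] (derivative w) = derivative^[k + 1] w := fun k =>
    (Function.iterate_succ_apply _ _ _).symm
  have e4 : derivative^[n] (X * derivative w) = X * derivative^[n + 1] w
      + (n : ℝ[X]) * derivative^[n] w := by
    rcases n with _ | n
    · simp
    · rw [iterate_derivative_succ_X_mul, d1, d1]; push_cast; ring
  rw [e3, iterate_derivative_sub, iterate_derivative_succ_X_mul, iterate_derivative_succ_X_mul,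
    iterate_derivative_succ_X_mul, d1, d1, e4] at h1
  have hP : legendreP n = C (1 / ((2 : ℝ) ^ n * (Nat.factorial n : ℝ))) * derivative^[n] w := rfl
  have d2 : ∀ k, derivative (derivative^[k] w) = derivative^[k + 1] w := fun k =>
    (Function.iterate_succ_apply' _ _ _).symm
  rw [hP]
  simp only [derivative_C_mul, d2]
  linear_combination (-C (1 / ((2 : ℝ) ^ n * (Nat.factorial n : ℝ)))) * h1

theorem legendreP_comp_neg_X (n : ℕ) :
    (legendreP n).comp (-X) = (-1) ^ n * legendreP n := by
  have h : ((X ^ 2 - 1 : ℝ[X]) ^ n).comp (-X) = (X ^ 2 - 1) ^ n := by simp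
  have h2 := iterate_derivative_comp_neg_X ((X ^ 2 - 1 : ℝ[X]) ^ n) n
  rw [h] at h2
  rw [legendreP]
  simp only [mul_comp, C_comp]
  nth_rewrite 2 [h2]
  have : ((-1 : ℝ[X]) ^ n) * (-1) ^ n = 1 := by rw [← mul_pow]; simp
  linear_combination (-C (1 / ((2 : ℝ) ^ n * (Nat.factorial n : ℝ))) *
     (derivative^[n] ((X ^ 2 - 1 : ℝ[X]) ^ n)).comp (-X)) * this

theorem legendreP_eval_neg (n : ℕ) (x : ℝ) :
    (legendreP n).eval (-x) = (-1) ^ n * (legendreP n).eval x := by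
  have := congrArg (eval x) (legendreP_comp_neg_X n)
  simpa [eval_comp] using this

theorem abs_legendreP_neg (n : ℕ) (x : ℝ) :
    |(legendreP n).eval (-x)| = |(legendreP n).eval x| := by
  rw [legendreP_eval_neg, abs_mul, abs_pow]; simp

theorem derivative_legendreP_eval_neg (n : ℕ) (x : ℝ) :
    (derivative (legendreP n)).eval (-x) = -((-1) ^ n * (derivative (legendreP n)).eval x) := by
  have h := congrArg derivative (legendreP_comp_neg_X n)
  have hc : ((-1 : ℝ[X]) ^ n) = C ((-1) ^ n) := by simp
  rw [derivative_comp, hc, derivative_C_mul] at h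
  have := congrArg (eval x) h
  simp [eval_comp] at this
  linarith

theorem abs_derivative_legendreP_neg (n : ℕ) (x : ℝ) :
    |(derivative (legendreP n)).eval (-x)| = |(derivative (legendreP n)).eval x| := by
  rw [derivative_legendreP_eval_neg, abs_neg, abs_mul, abs_pow]; simp

theorem legendreP_eval_one (n : ℕ) : (legendreP n).eval 1 = 1 := by
  -- In the Leibniz expansion at 1 only the term with all n derivatives on (X - 1)^n survives.
  have hw : (X ^ 2 - 1 : ℝ[X]) ^ n = (X - C 1) ^ n * (X + C 1) ^ n := by
    rw [← mul_pow]; congr 1; simp; ring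
  rw [legendreP, hw, iterate_derivative_mul, eval_C_mul, eval_finsetSum,
    Finset.sum_eq_single 0]
  · rw [iterate_derivative_X_sub_pow]
    simp [Nat.descFactorial_self]
    have : (1 : ℝ) + 1 = 2 := by norm_num
    rw [this]; field_simp
  · intro k hk hk0
    have hk' : k ≤ n := by simpa [Nat.lt_succ_iff] using hk
    have : n - (n - k) ≠ 0 := by omega
    rw [iterate_derivative_X_sub_pow]
    simp [this]
  · simp

/-- Sharp order of the largest binomial coefficient, needed for the values of P_n and P_n' at 0. The
even case is an induction resting on (2m+1)(2m+3) ≤ 4(m+1)²; the odd case halves the next central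
coefficient. -/
theorem choose_sq_mul_succ_le (n j : ℕ) : n.choose j ^ 2 * (n + 1) ≤ 4 ^ n := by
  have hcb : ∀ m : ℕ, Nat.centralBinom m ^ 2 * (2 * m + 1) ≤ 16 ^ m := by
    intro m
    induction m with
    | zero => simp
    | succ m ih =>
      have h := Nat.succ_mul_centralBinom_succ m
      have h2 : (m + 1) ^ 2 * (Nat.centralBinom (m + 1) ^ 2 * (2 * (m + 1) + 1)) ≤
          (m + 1) ^ 2 * 16 ^ (m + 1) := by
        calc _ = ((m + 1) * Nat.centralBinom (m + 1)) ^ 2 * (2 * m + 3) := by ring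
          _ = (4 * ((2 * m + 1) * (2 * m + 3))) * (Nat.centralBinom m ^ 2 * (2 * m + 1)) := by
            rw [h]; ring
          _ ≤ (4 * (4 * (m + 1) ^ 2)) * 16 ^ m := by
            refine Nat.mul_le_mul (Nat.mul_le_mul_left _ ?_) ih
            nlinarith
          _ = _ := by ring
      exact Nat.le_of_mul_le_mul_left h2 (by positivity)
  have h1 := Nat.choose_le_middle j n
  refine le_trans (Nat.mul_le_mul_right _ (Nat.pow_le_pow_left h1 2)) ?_
  obtain ⟨m, rfl | rfl⟩ := Nat.even_or_odd' n
  · have := hcb m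
    rw [Nat.centralBinom] at this
    rw [show 2 * m / 2 = m by omega, pow_mul]
    exact this
  · have := hcb (m + 1)
    have hc : Nat.centralBinom (m + 1) = 2 * (2 * m + 1).choose m := by
      rw [Nat.centralBinom, show 2 * (m + 1) = (2 * m + 1) + 1 by ring, Nat.choose_succ_succ,
        ← Nat.choose_symm_half m]
      ring
    rw [hc] at this
    rw [show (2 * m + 1) / 2 = m by omega, pow_succ 4, pow_mul]
    rw [pow_succ 16] at this
    norm_num
    nlinarith [sq_nonneg ((2 * m + 1).choose m)]

theorem coeff_X_sq_sub_one_pow_sq_le (n m : ℕ) :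
    (((X ^ 2 - 1 : ℝ[X]) ^ n).coeff m) ^ 2 * (n + 1) ≤ 4 ^ n := by
  have : (X ^ 2 - 1 : ℝ[X]) ^ n = expand ℝ 2 ((X + C (-1)) ^ n) := by simp [sub_eq_add_neg]
  rw [this, coeff_expand (by norm_num)]
  split_ifs
  · rw [coeff_X_add_C_pow]
    have h := choose_sq_mul_succ_le n (m / 2)
    have h' : ((n.choose (m / 2) : ℝ)) ^ 2 * (n + 1) ≤ 4 ^ n := by exact_mod_cast h
    rw [mul_pow, ← pow_mul, mul_comm (n - m / 2) 2, pow_mul]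
    simpa using h'
  · simp

theorem legendreP_eval_zero_sq_le (n : ℕ) :
    (legendreP n).eval 0 ^ 2 * (n + 1) ≤ 1 := by
  have h := coeff_X_sq_sub_one_pow_sq_le n n
  rw [← coeff_zero_eq_eval_zero, legendreP, coeff_C_mul, coeff_iterate_derivative]
  simp only [zero_add, Nat.descFactorial_self, nsmul_eq_mul]
  have hf : (n.factorial : ℝ) ≠ 0 := by positivity
  rw [show (4 : ℝ) ^ n = (2 ^ n) ^ 2 by rw [← pow_mul, mul_comm n 2, pow_mul]; norm_num] at h
  field_simp
  linarith

theorem derivative_legendreP_eval_zero_sq_le (n : ℕ) :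
    (derivative (legendreP n)).eval 0 ^ 2 ≤ n + 1 := by
  have h := coeff_X_sq_sub_one_pow_sq_le n (n + 1)
  rw [← coeff_zero_eq_eval_zero, coeff_derivative, legendreP, coeff_C_mul,
    coeff_iterate_derivative]
  have : (0 + 1 + n).descFactorial n = (n + 1).factorial := by
    have := Nat.factorial_mul_descFactorial (n := n + 1) (k := n) (by omega)
    rw [show 0 + 1 + n = n + 1 by ring]
    simpa using this
  rw [this, show 0 + 1 + n = n + 1 by ring, Nat.factorial_succ]
  simp only [nsmul_eq_mul]
  have hf : (n.factorial : ℝ) ≠ 0 := by positivity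
  rw [show (4 : ℝ) ^ n = (2 ^ n) ^ 2 by rw [← pow_mul, mul_comm n 2, pow_mul]; norm_num] at h
  push_cast
  have e : (1 / (2 ^ n * (n.factorial : ℝ)) * (((n : ℝ) + 1) * (n.factorial : ℝ) *
      ((X ^ 2 - 1 : ℝ[X]) ^ n).coeff (n + 1)) * (0 + 1)) ^ 2 =
      ((n : ℝ) + 1) * ((((X ^ 2 - 1 : ℝ[X]) ^ n).coeff (n + 1)) ^ 2 * (n + 1)) / (2 ^ n) ^ 2 := by
    field_simp
    ring
  rw [e, div_le_iff₀ (by positivity)]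
  exact mul_le_mul_of_nonneg_left h (by positivity)

/-! ### Orthogonality on [-1, 1]. -/

theorem natDegree_legendreP_le (n : ℕ) : (legendreP n).natDegree ≤ n := by
  rw [legendreP]
  refine (natDegree_C_mul_le _ _).trans ((natDegree_iterate_derivative _ _).trans ?_)
  have : ((X ^ 2 - 1 : ℝ[X]) ^ n).natDegree ≤ n * 2 := by
    refine natDegree_pow_le_of_le n ?_
    compute_degree
  omega

theorem integral_eval_derivative (p : ℝ[X]) (a b : ℝ) :
    ∫ x in a..b, (derivative p).eval x = p.eval b - p.eval a :=
  intervalIntegral.integral_eq_sub_of_hasDerivAt (fun x _ => p.hasDerivAt x)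
    ((derivative p).continuous.intervalIntegrable _ _)

/-- The operator q ↦ ((1-x²) q')' is symmetric, and P_n has eigenvalue -n(n+1). It sends x^k to
-k(k+1) x^k + k(k-1) x^(k-2), so the k-th moment is a multiple of the moment k - 2, and the
eigenvalues differ for k < n. -/
theorem integral_legendreP_mul_pow_eq_zero (n : ℕ) :
    ∀ k < n, ∫ x in (-1 : ℝ)..1, (legendreP n).eval x * x ^ k = 0 := by
  have key : ∀ q : ℝ[X], ∫ x in (-1 : ℝ)..1, ((legendreP n) * ((n : ℝ[X]) * ((n : ℝ[X]) + 1) * q +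
      ((1 - X ^ 2) * derivative (derivative q) - 2 * X * derivative q))).eval x = 0 := by
    intro q
    have h := integral_eval_derivative
      ((1 - X ^ 2) * (legendreP n * derivative q - derivative (legendreP n) * q)) (-1) 1
    have e : derivative ((1 - X ^ 2) * (legendreP n * derivative q - derivative (legendreP n) * q))
        = legendreP n * ((n : ℝ[X]) * ((n : ℝ[X]) + 1) * q +
      ((1 - X ^ 2) * derivative (derivative q) - 2 * X * derivative q)) := by
      simp only [derivative_mul, derivative_sub, derivative_one, derivative_X_pow]
      simp only [Nat.cast_ofNat, map_ofNat, Nat.add_one_sub_one, pow_one]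
      linear_combination (-q) * legendreP_ode n
    rw [e] at h
    rw [h]; simp
  intro k
  induction k using Nat.strong_induction_on with
  | _ k ih =>
    intro hk
    have h := key (X ^ k)
    have hne : ((n : ℝ) * (n + 1) - k * (k + 1)) ≠ 0 := by
      have : (k : ℝ) + 1 ≤ n := by exact_mod_cast hk
      nlinarith [(k.cast_nonneg : (0 : ℝ) ≤ k)]
    have hI : ∀ f : ℝ[X], IntervalIntegrable (fun x => f.eval x) volume (-1) 1 :=
      fun f => f.continuous.intervalIntegrable _ _
    rcases k with _ | _ | k
    · simp only [pow_zero, mul_one, derivative_one, derivative_zero, mul_zero, sub_zero,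
        add_zero, eval_mul, eval_natCast, eval_add, eval_one] at h
      rw [intervalIntegral.integral_mul_const] at h
      simp only [pow_zero, mul_one]
      simpa [hne] using (mul_eq_zero.mp h).resolve_right (by simpa using hne)
    · have e : ∀ x : ℝ, ((legendreP n) * ((n : ℝ[X]) * ((n : ℝ[X]) + 1) * X ^ (0 + 1) +
          ((1 - X ^ 2) * derivative (derivative (X ^ (0 + 1))) -
          2 * X * derivative (X ^ (0 + 1))))).eval x =
          ((legendreP n).eval x * x ^ (0 + 1)) * ((n : ℝ) * (n + 1) - (0 + 1 : ℕ) * ((0 + 1 : ℕ) + 1)) := by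
        intro x; simp; ring
      simp_rw [e] at h
      rw [intervalIntegral.integral_mul_const] at h
      exact (mul_eq_zero.mp h).resolve_right hne
    · have e : ∀ x : ℝ, ((legendreP n) * ((n : ℝ[X]) * ((n : ℝ[X]) + 1) * X ^ (k + 1 + 1) +
          ((1 - X ^ 2) * derivative (derivative (X ^ (k + 1 + 1))) -
          2 * X * derivative (X ^ (k + 1 + 1))))).eval x =
          ((legendreP n).eval x * x ^ (k + 1 + 1)) *
            ((n : ℝ) * (n + 1) - (k + 1 + 1 : ℕ) * ((k + 1 + 1 : ℕ) + 1)) +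
          ((legendreP n).eval x * x ^ k) * ((k + 2) * (k + 1)) := by
        intro x
        simp
        ring
      simp_rw [e] at h
      rw [intervalIntegral.integral_add, intervalIntegral.integral_mul_const,
        intervalIntegral.integral_mul_const, ih k (by omega) (by omega), zero_mul, add_zero] at h
      · exact (mul_eq_zero.mp h).resolve_right hne
      · apply Continuous.intervalIntegrable; fun_prop
      · apply Continuous.intervalIntegrable; fun_prop

theorem integral_legendreP_mul_eq_zero {n : ℕ} {q : ℝ[X]} (hq : q.degree < n) :
    ∫ x in (-1 : ℝ)..1, (legendreP n).eval x * q.eval x = 0 := by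
  have : ∀ x : ℝ, (legendreP n).eval x * q.eval x =
      ∑ k ∈ Finset.range n, ((legendreP n).eval x * x ^ k) * q.coeff k := by
    intro x
    rcases eq_or_ne q 0 with rfl | h0
    · simp
    rw [eval_eq_sum_range' ((natDegree_lt_iff_degree_lt h0).mpr hq), Finset.mul_sum]
    exact Finset.sum_congr rfl fun k _ => by ring
  simp_rw [this]
  rw [intervalIntegral.integral_finsetSum]
  · refine Finset.sum_eq_zero fun k hk => ?_
    rw [intervalIntegral.integral_mul_const,
      integral_legendreP_mul_pow_eq_zero n k (Finset.mem_range.mp hk), zero_mul]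
  · intro k _
    apply Continuous.intervalIntegrable; fun_prop

theorem eq_zero_of_integral_sq_eq_zero {q : ℝ[X]}
    (h : ∫ x in (-1 : ℝ)..1, q.eval x * q.eval x = 0) : q = 0 := by
  by_contra hq
  have hpos : 0 < ∫ x in (-1 : ℝ)..1, q.eval x * q.eval x := by
    obtain ⟨c, hc, hc0⟩ : ∃ c ∈ Set.Icc (-1 : ℝ) 1, q.eval c ≠ 0 := by
      by_contra! hcon
      exact hq (eq_zero_of_infinite_isRoot q
        ((Set.Icc_infinite (by norm_num : (-1 : ℝ) < 1)).mono fun x hx => hcon x hx))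
    refine intervalIntegral.integral_pos (by norm_num) (by fun_prop)
      (fun x _ => mul_self_nonneg _) ⟨c, hc, mul_self_pos.mpr hc0⟩
  linarith

theorem legendreP_coeff_self_ne_zero (n : ℕ) : (legendreP n).coeff n ≠ 0 := by
  intro h
  have hd : (legendreP n).degree < n := by
    rw [degree_lt_iff_coeff_zero]
    intro m hm
    rcases hm.eq_or_lt with rfl | hm
    · exact h
    · exact coeff_eq_zero_of_natDegree_lt ((natDegree_legendreP_le n).trans_lt hm)
  have := eq_zero_of_integral_sq_eq_zero (integral_legendreP_mul_eq_zero hd)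
  have h1 := legendreP_eval_one n
  rw [this] at h1
  simp at h1

/-- A polynomial of degree at most `n` which is orthogonal to all polynomials of degree less
than `n` is a multiple of the Legendre polynomial. -/
theorem eq_smul_legendreP {n : ℕ} {g : ℝ[X]} (hg : g.natDegree ≤ n)
    (h : ∀ k < n, ∫ x in (-1 : ℝ)..1, g.eval x * x ^ k = 0) :
    g = C (g.eval 1) * legendreP n := by
  -- With this c the difference d has degree below n; it is then orthogonal to g and to P_n, hence
  -- to itself.
  set c := g.coeff n / (legendreP n).coeff n with hc
  set d := g - C c * legendreP n with hd
  have hdd : d.degree < n := by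
    rw [degree_lt_iff_coeff_zero]
    intro m hm
    rcases hm.eq_or_lt with rfl | hm
    · rw [hd, coeff_sub, coeff_C_mul, hc]
      rw [div_mul_cancel₀ _ (legendreP_coeff_self_ne_zero n), sub_self]
    · rw [hd, coeff_sub, coeff_C_mul, coeff_eq_zero_of_natDegree_lt (hg.trans_lt hm),
        coeff_eq_zero_of_natDegree_lt ((natDegree_legendreP_le n).trans_lt hm)]
      simp
  have h0 : d = 0 := by
    rcases eq_or_ne d 0 with h00 | h00
    · exact h00
    apply eq_zero_of_integral_sq_eq_zero
    have h2 := integral_legendreP_mul_eq_zero hdd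
    have h1 : ∫ x in (-1 : ℝ)..1, g.eval x * d.eval x = 0 := by
      have : ∀ x : ℝ, g.eval x * d.eval x =
          ∑ k ∈ Finset.range n, (g.eval x * x ^ k) * d.coeff k := by
        intro x
        rw [eval_eq_sum_range' (p := d) ((natDegree_lt_iff_degree_lt h00).mpr hdd), Finset.mul_sum]
        exact Finset.sum_congr rfl fun k _ => by ring
      simp_rw [this]
      rw [intervalIntegral.integral_finsetSum]
      · refine Finset.sum_eq_zero fun k hk => ?_
        rw [intervalIntegral.integral_mul_const, h k (Finset.mem_range.mp hk), zero_mul]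
      · intro k _
        apply Continuous.intervalIntegrable; fun_prop
    have e : ∀ x : ℝ, d.eval x * d.eval x =
        g.eval x * d.eval x - c * ((legendreP n).eval x * d.eval x) := by
      intro x
      have : d.eval x = g.eval x - c * (legendreP n).eval x := by rw [hd]; simp
      calc d.eval x * d.eval x = d.eval x * (g.eval x - c * (legendreP n).eval x) := by
            rw [← this]
        _ = _ := by ring
    simp_rw [e]
    rw [intervalIntegral.integral_sub, h1, intervalIntegral.integral_const_mul, h2]
    · simp
    · apply Continuous.intervalIntegrable; fun_prop
    · apply Continuous.intervalIntegrable; fun_prop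
  have hgc : g = C c * legendreP n := sub_eq_zero.mp h0
  have : g.eval 1 = c := by rw [hgc]; simp [legendreP_eval_one]
  rw [this]; exact hgc

/-! ### Pointwise bounds from the differential equation. -/

theorem legendreP_ode_eval (n : ℕ) (x : ℝ) :
    (1 - x ^ 2) * (derivative (derivative (legendreP n))).eval x =
      2 * x * (derivative (legendreP n)).eval x - n * (n + 1) * (legendreP n).eval x := by
  have := congrArg (eval x) (legendreP_ode n)
  simpa using this

/-- By the differential equation the left side has derivative 2x P_n'², so it increases on [0, 1] up
to its value at 1. -/
theorem legendreP_energy_le {n : ℕ} {x : ℝ} (h0 : 0 ≤ x) (h1 : x ≤ 1) :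
    n * (n + 1) * (legendreP n).eval x ^ 2 + (1 - x ^ 2) * (derivative (legendreP n)).eval x ^ 2
      ≤ n * (n + 1) := by
  set E : ℝ[X] := (n : ℝ[X]) * ((n : ℝ[X]) + 1) * legendreP n ^ 2 +
    (1 - X ^ 2) * derivative (legendreP n) ^ 2 with hE
  have hd : derivative E = 2 * X * derivative (legendreP n) ^ 2 := by
    rw [hE]
    simp only [derivative_mul, derivative_sub, derivative_one, derivative_add,
      derivative_pow, derivative_natCast, derivative_X]
    simp only [Nat.cast_ofNat, map_ofNat, Nat.add_one_sub_one, pow_one]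
    linear_combination (2 * derivative (legendreP n)) * legendreP_ode n
  have hmono : MonotoneOn (fun y => E.eval y) (Set.Icc 0 1) := by
    refine monotoneOn_of_deriv_nonneg (convex_Icc 0 1) (by fun_prop)
      (by fun_prop) fun y hy => ?_
    rw [interior_Icc] at hy
    rw [Polynomial.deriv, hd]
    simp only [eval_mul, eval_pow, eval_X, eval_ofNat]
    have := hy.1
    positivity
  have := hmono ⟨h0, h1⟩ (Set.right_mem_Icc.mpr zero_le_one) h1
  simpa [hE, legendreP_eval_one] using this

theorem one_sub_sq_mul_derivative_legendreP_sq_le {n : ℕ} {x : ℝ} (h0 : 0 ≤ x) (h1 : x ≤ 1) :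
    (1 - x ^ 2) * (derivative (legendreP n)).eval x ^ 2 ≤ n * (n + 1) := by
  have := legendreP_energy_le (n := n) h0 h1
  have h2 : 0 ≤ (n : ℝ) * (n + 1) * (legendreP n).eval x ^ 2 := by positivity
  linarith

theorem abs_legendreP_le_one {n : ℕ} (hn : 1 ≤ n) {x : ℝ} (hx : x ∈ Set.Icc (-1 : ℝ) 1) :
    |(legendreP n).eval x| ≤ 1 := by
  have main : ∀ y : ℝ, 0 ≤ y → y ≤ 1 → |(legendreP n).eval y| ≤ 1 := by
    intro y h0 h1
    have h := legendreP_energy_le (n := n) h0 h1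
    have h2 : 0 ≤ (1 - y ^ 2) * (derivative (legendreP n)).eval y ^ 2 :=
      mul_nonneg (by nlinarith) (sq_nonneg _)
    have hN : (0 : ℝ) < n * (n + 1) := by positivity
    rw [← sq_le_one_iff_abs_le_one]
    by_contra! hc
    nlinarith
  rcases le_total 0 x with h | h
  · exact main x h hx.2
  · rw [← abs_legendreP_neg]; exact main (-x) (by linarith) (by linarith [hx.1])

/-- With x = cos θ, u = √(sin θ) P_n(cos θ) solves u'' + φ u = 0, where φ = ((2n+1)² sin² θ + 1) /
(4 sin² θ). The left side is the Sonin function u² + u'²/φ. Since φ decreases on (0, π/2), it is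
largest at x = 0, where the central binomial bounds apply. -/
theorem legendreP_amplitude_le {n : ℕ} (hn : 1 ≤ n) {x : ℝ} (h0 : 0 ≤ x) (h1 : x < 1) :
    √(1 - x ^ 2) * ((legendreP n).eval x ^ 2 +
      (x * (legendreP n).eval x - 2 * (1 - x ^ 2) * (derivative (legendreP n)).eval x) ^ 2 /
        ((2 * n + 1) ^ 2 * (1 - x ^ 2) + 1)) ≤ 2 / n := by
  set P := legendreP n with hP
  set F : ℝ → ℝ := fun x => √(1 - x ^ 2) * (P.eval x ^ 2 +
      (x * P.eval x - 2 * (1 - x ^ 2) * (derivative P).eval x) ^ 2 /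
        ((2 * n + 1) ^ 2 * (1 - x ^ 2) + 1)) with hF
  have hder : ∀ y ∈ Set.Ico (0 : ℝ) 1, HasDerivAt F (-(2 * y *
      (y * P.eval y - 2 * (1 - y ^ 2) * (derivative P).eval y) ^ 2 /
        (√(1 - y ^ 2) * ((2 * n + 1) ^ 2 * (1 - y ^ 2) + 1) ^ 2))) y := by
    intro y hy
    have hs : 0 < 1 - y ^ 2 := by nlinarith [hy.1, hy.2]
    have hs1 : HasDerivAt (fun y : ℝ => 1 - y ^ 2) (-(2 * y)) y := by
      simpa using (hasDerivAt_pow 2 y).const_sub 1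
    have hD : (0 : ℝ) < (2 * n + 1) ^ 2 * (1 - y ^ 2) + 1 := by positivity
    have hV := ((hasDerivAt_id y).mul (P.hasDerivAt y)).sub
      ((hs1.const_mul 2).mul ((derivative P).hasDerivAt y))
    have hall := (hs1.sqrt hs.ne').mul (((P.hasDerivAt y).pow 2).add
      ((hV.pow 2).div ((hs1.const_mul ((2 * (n : ℝ) + 1) ^ 2)).add_const 1) hD.ne'))
    have hode := legendreP_ode_eval n y
    rw [← hP] at hode
    refine (hall.congr_deriv ?_)
    simp only [id, Pi.mul_apply, Pi.sub_apply, Pi.add_apply, Pi.pow_apply, Pi.div_apply]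
    have hq : √(1 - y ^ 2) ^ 2 = 1 - y ^ 2 := Real.sq_sqrt hs.le
    have hq0 : √(1 - y ^ 2) ≠ 0 := (Real.sqrt_pos.mpr hs).ne'
    set r := √(1 - y ^ 2)
    have e : 1 * eval y P + y * eval y (derivative P) - (2 * -(2 * y) * eval y (derivative P) +
        2 * (1 - y ^ 2) * eval y (derivative (derivative P))) =
        eval y P + y * eval y (derivative P) + 2 * (n * (n + 1)) * eval y P := by
      linear_combination (-2) * hode
    rw [e]

    have hD' := hD.ne'
    field_simp
    rw [hq]
    ring
  have hanti : AntitoneOn F (Set.Ico 0 1) := by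
    refine antitoneOn_of_deriv_nonpos (convex_Ico 0 1)
      (fun y hy => (hder y hy).continuousAt.continuousWithinAt)
      (fun y hy => ?_) fun y hy => ?_
    · exact (hder y (interior_subset hy)).differentiableAt.differentiableWithinAt
    · have hy' := interior_subset hy
      rw [(hder y hy').deriv]
      have := hy'.1
      rw [neg_nonpos]
      positivity
  refine (hanti (Set.left_mem_Ico.mpr one_pos) ⟨h0, h1⟩ h0).trans ?_
  have a := legendreP_eval_zero_sq_le n
  have b := derivative_legendreP_eval_zero_sq_le n
  rw [← hP] at a b
  have hn' : (1 : ℝ) ≤ n := by exact_mod_cast hn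
  have ha : P.eval 0 ^ 2 ≤ 1 / n := by
    rw [le_div_iff₀ (by linarith)]; nlinarith [sq_nonneg (P.eval 0)]
  have hb : (2 * (derivative P).eval 0) ^ 2 / ((2 * n + 1) ^ 2 + 1) ≤ 1 / (n : ℝ) := by
    rw [div_le_div_iff₀ (by positivity) (by linarith)]
    nlinarith
  have : F 0 = P.eval 0 ^ 2 + (2 * (derivative P).eval 0) ^ 2 / ((2 * n + 1) ^ 2 + 1) := by
    simp [hF]
  rw [this]
  calc _ ≤ 1 / (n : ℝ) + 1 / n := add_le_add ha hb
    _ = _ := by ring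

theorem sqrt_mul_legendreP_sq_le {n : ℕ} (hn : 1 ≤ n) {x : ℝ} (h0 : 0 ≤ x) (h1 : x < 1) :
    √(1 - x ^ 2) * (legendreP n).eval x ^ 2 ≤ 2 / n := by
  refine le_trans ?_ (legendreP_amplitude_le hn h0 h1)
  have hs : 0 < 1 - x ^ 2 := by nlinarith
  refine mul_le_mul_of_nonneg_left (le_add_of_nonneg_right ?_) (Real.sqrt_nonneg _)
  positivity

/-- The amplitude bound controls xP - 2(1-x²)P', and the xP part is removed by Bernstein's
inequality. The condition n²(1-x²) ≥ 1 absorbs the additive constants into the main term. -/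
theorem sqrt_mul_derivative_legendreP_sq_le {n : ℕ} (hn : 1 ≤ n) {x : ℝ} (h0 : 0 ≤ x)
    (h1 : x < 1) (hx : 1 / (n : ℝ) ^ 2 ≤ 1 - x ^ 2) :
    √(1 - x ^ 2) * (1 - x ^ 2) * (derivative (legendreP n)).eval x ^ 2 ≤ 11 * n := by
  have hA := sqrt_mul_legendreP_sq_le hn h0 h1
  have hF := legendreP_amplitude_le hn h0 h1
  have hn' : (1 : ℝ) ≤ n := by exact_mod_cast hn
  have hs : 0 < 1 - x ^ 2 := by nlinarith
  have hr := Real.sqrt_nonneg (1 - x ^ 2)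
  set P := (legendreP n).eval x
  set P' := (derivative (legendreP n)).eval x
  set s := 1 - x ^ 2 with hsdef
  set r := √s
  have hD : (0 : ℝ) < (2 * n + 1) ^ 2 * s + 1 := by positivity
  have hV : r * (x * P - 2 * s * P') ^ 2 ≤ 2 / n * ((2 * n + 1) ^ 2 * s + 1) := by
    rw [← div_le_iff₀ hD, mul_div_assoc]
    refine le_trans (mul_le_mul_of_nonneg_left ?_ hr) hF
    exact le_add_of_nonneg_left (sq_nonneg _)
  have hns : 1 ≤ n ^ 2 * s := by
    rw [div_le_iff₀ (by positivity)] at hx; linarith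
  have h2 : (2 * s * P') ^ 2 ≤ 2 * (x * P - 2 * s * P') ^ 2 + 2 * P ^ 2 := by
    have : (x * P) ^ 2 ≤ P ^ 2 := by
      rw [mul_pow]; exact mul_le_of_le_one_left (sq_nonneg _) (by nlinarith)
    nlinarith [sq_nonneg (2 * (x * P) - 2 * s * P')]
  have h3 : r * (2 * s * P') ^ 2 ≤ 4 / n * ((2 * n + 1) ^ 2 * s + 2) := by
    calc r * (2 * s * P') ^ 2 ≤ r * (2 * (x * P - 2 * s * P') ^ 2 + 2 * P ^ 2) :=
          mul_le_mul_of_nonneg_left h2 hr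
      _ = 2 * (r * (x * P - 2 * s * P') ^ 2) + 2 * (r * P ^ 2) := by ring
      _ ≤ 2 * (2 / n * ((2 * n + 1) ^ 2 * s + 1)) + 2 * (2 / n) := by gcongr
      _ = _ := by ring
  have h4 : 4 / n * ((2 * n + 1) ^ 2 * s + 2) ≤ 44 * n * s := by
    rw [div_mul_eq_mul_div, div_le_iff₀ (by linarith)]
    nlinarith [mul_nonneg (mul_nonneg (by linarith : (0:ℝ) ≤ n - 1) (by linarith : (0:ℝ) ≤ 5 * n + 1)) hs.le]
  have h5 : (4 * s) * (r * s * P' ^ 2) ≤ (4 * s) * (11 * n) := by nlinarith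
  exact le_of_mul_le_mul_left h5 (by positivity)

/-! ### Integral bounds: L^p norms and the third moment. -/

theorem integral_eq_two_mul_integral_of_even {f : ℝ → ℝ} (hf : Continuous f)
    (he : ∀ x, f (-x) = f x) : ∫ x in (-1 : ℝ)..1, f x = 2 * ∫ x in (0 : ℝ)..1, f x := by
  rw [← intervalIntegral.integral_add_adjacent_intervals (b := 0) (hf.intervalIntegrable _ _)
    (hf.intervalIntegrable _ _)]
  have := intervalIntegral.integral_comp_neg (a := 0) (b := 1) f
  simp only [he, neg_zero] at this
  rw [this]; ring

theorem intervalIntegrable_one_sub_rpow {a : ℝ} (ha : -1 < a) :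
    IntervalIntegrable (fun x : ℝ => (1 - x) ^ a) volume 0 1 := by
  have := (intervalIntegral.intervalIntegrable_rpow' (a := 1) (b := 0) ha).comp_sub_left 1
  simpa using this

/-- The `L^p` norms of the Legendre polynomials for `p < 4`. -/
theorem integral_abs_legendreP_rpow_le {p : ℝ} (hp : 0 ≤ p) (hp4 : p < 4) :
    ∃ C : ℝ, 0 ≤ C ∧ ∀ n : ℕ, 1 ≤ n →
      ∫ x in (-1 : ℝ)..1, |(legendreP n).eval x| ^ p ≤ C * (n : ℝ) ^ (-(p / 2)) := by
  -- Bernstein's inequality gives |P|^p ≤ (2/n)^(p/2) (1-x)^(-p/4), integrable exactly because p <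
  -- 4; the outer 2 accounts for the two halves of [-1, 1].
  refine ⟨2 * (2 ^ (p / 2) * ∫ x in (0 : ℝ)..1, (1 - x) ^ (-(p / 4))), ?_, fun n hn => ?_⟩
  · have : 0 ≤ ∫ x in (0 : ℝ)..1, (1 - x) ^ (-(p / 4)) :=
      intervalIntegral.integral_nonneg zero_le_one fun x hx =>
        Real.rpow_nonneg (by linarith [hx.2]) _
    positivity
  have hn' : (1 : ℝ) ≤ n := by exact_mod_cast hn
  have hcont : Continuous fun x : ℝ => |(legendreP n).eval x| ^ p :=
    ((legendreP n).continuous.abs).rpow_const fun x => Or.inr hp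
  rw [integral_eq_two_mul_integral_of_even hcont (fun x => by rw [abs_legendreP_neg]),
    mul_assoc]
  refine mul_le_mul_of_nonneg_left ?_ zero_le_two
  have : 2 ^ (p / 2) * (∫ x in (0 : ℝ)..1, (1 - x) ^ (-(p / 4))) * (n : ℝ) ^ (-(p / 2)) =
      ∫ x in (0 : ℝ)..1, 2 ^ (p / 2) * (n : ℝ) ^ (-(p / 2)) * (1 - x) ^ (-(p / 4)) := by
    rw [intervalIntegral.integral_const_mul]; ring
  rw [this]
  refine intervalIntegral.integral_mono_on_of_le_Ioo zero_le_one (hcont.intervalIntegrable _ _)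
    ((intervalIntegrable_one_sub_rpow (by linarith)).const_mul _) fun x hx => ?_
  have hs : 0 < 1 - x ^ 2 := by nlinarith [hx.1, hx.2]
  have hs1 : 1 - x ≤ 1 - x ^ 2 := by nlinarith [hx.1, hx.2]
  have hx1 : 0 < 1 - x := by linarith [hx.2]
  have h := sqrt_mul_legendreP_sq_le hn hx.1.le hx.2
  have h2 : (legendreP n).eval x ^ 2 ≤ 2 / n * (1 - x) ^ (-(1 / 2) : ℝ) := by
    have hr : (1 - x) ^ (1 / 2 : ℝ) ≤ √(1 - x ^ 2) := by
      rw [Real.sqrt_eq_rpow]; exact Real.rpow_le_rpow hx1.le hs1 (by norm_num)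
    rw [Real.rpow_neg hx1.le, ← div_eq_mul_inv, le_div_iff₀ (by positivity), mul_comm]
    exact (mul_le_mul_of_nonneg_right hr (sq_nonneg _)).trans h
  calc |(legendreP n).eval x| ^ p = ((legendreP n).eval x ^ 2) ^ (p / 2) := by
        rw [← sq_abs, ← Real.rpow_natCast, ← Real.rpow_mul (abs_nonneg _)]
        congr 1; push_cast; ring
    _ ≤ (2 / n * (1 - x) ^ (-(1 / 2) : ℝ)) ^ (p / 2) :=
        Real.rpow_le_rpow (sq_nonneg _) h2 (by linarith)
    _ = _ := by
        rw [Real.mul_rpow (by positivity) (by positivity), Real.div_rpow zero_le_two (by positivity),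
          ← Real.rpow_mul hx1.le, Real.rpow_neg (by positivity), div_eq_mul_inv]
        congr 2; ring

/-- An exact primitive that vanishes at ±1. It captures the cancellation in ∫P_n³: estimating |P_n|³
directly gives only n^(-3/2), whereas the factor (n(n+1))² against a right side of size n² gives
n^(-2). -/
theorem integral_legendreP_cube_eq (n : ℕ) :
    3 * ((n : ℝ) * (n + 1)) ^ 2 * ∫ x in (-1 : ℝ)..1, (legendreP n).eval x ^ 3 =
      4 * ∫ x in (-1 : ℝ)..1, x * ((1 - x ^ 2) * (derivative (legendreP n)).eval x ^ 3) := by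
  set P := legendreP n with hP
  have h := integral_eval_derivative (3 * ((n : ℝ[X]) * ((n : ℝ[X]) + 1)) *
    (P ^ 2 * ((1 - X ^ 2) * derivative P)) + 2 * ((1 - X ^ 2) ^ 2 * derivative P ^ 3)) (-1) 1
  have e : derivative (3 * ((n : ℝ[X]) * ((n : ℝ[X]) + 1)) *
      (P ^ 2 * ((1 - X ^ 2) * derivative P)) + 2 * ((1 - X ^ 2) ^ 2 * derivative P ^ 3)) =
      4 * (X * ((1 - X ^ 2) * derivative P ^ 3)) -
        3 * ((n : ℝ[X]) * ((n : ℝ[X]) + 1)) ^ 2 * P ^ 3 := by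
    simp only [derivative_mul, derivative_sub, derivative_one, derivative_add,
      derivative_pow, derivative_natCast, derivative_X, derivative_ofNat]
    simp only [Nat.cast_ofNat, map_ofNat, Nat.add_one_sub_one, pow_one]
    linear_combination (3 * ((n : ℝ[X]) * ((n : ℝ[X]) + 1)) * P ^ 2 +
      6 * (1 - X ^ 2) * derivative P ^ 2) * legendreP_ode n
  rw [e] at h
  have e2 : ∀ x : ℝ, (4 * (X * ((1 - X ^ 2) * derivative P ^ 3)) -
        3 * ((n : ℝ[X]) * ((n : ℝ[X]) + 1)) ^ 2 * P ^ 3).eval x =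
      4 * (x * ((1 - x ^ 2) * (derivative P).eval x ^ 3)) -
        3 * ((n : ℝ) * (n + 1)) ^ 2 * P.eval x ^ 3 := by
    intro x; simp
  simp_rw [e2] at h
  rw [intervalIntegral.integral_sub, intervalIntegral.integral_const_mul,
    intervalIntegral.integral_const_mul] at h
  · have z : (3 * ((n : ℝ[X]) * ((n : ℝ[X]) + 1)) * (P ^ 2 * ((1 - X ^ 2) * derivative P)) +
        2 * ((1 - X ^ 2) ^ 2 * derivative P ^ 3)).eval 1 -
        (3 * ((n : ℝ[X]) * ((n : ℝ[X]) + 1)) * (P ^ 2 * ((1 - X ^ 2) * derivative P)) +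
        2 * ((1 - X ^ 2) ^ 2 * derivative P ^ 3)).eval (-1) = 0 := by
      simp
    rw [z] at h
    linarith
  · apply Continuous.intervalIntegrable; fun_prop
  · apply Continuous.intervalIntegrable; fun_prop

/-- Used near the endpoint: the energy bound gives √(1-x²)|P'| ≤ 2n, which is cubed. -/
theorem one_sub_sq_mul_abs_derivative_legendreP_cube_le {n : ℕ} (hn : 1 ≤ n) {x : ℝ}
    (h0 : 0 ≤ x) (h1 : x < 1) :
    (1 - x ^ 2) * |(derivative (legendreP n)).eval x| ^ 3 ≤
      8 * n ^ 3 * (1 - x) ^ (-(1 / 2) : ℝ) := by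
  have hs1 : 1 - x ≤ 1 - x ^ 2 := by nlinarith
  have hx1 : 0 < 1 - x := by linarith
  have hs : 0 < 1 - x ^ 2 := by linarith
  have h := one_sub_sq_mul_derivative_legendreP_sq_le (n := n) h0 h1.le
  have hn' : (1 : ℝ) ≤ n := by exact_mod_cast hn
  rw [← sq_abs (eval x (derivative (legendreP n)))] at h
  set a := |(derivative (legendreP n)).eval x|
  have ha : 0 ≤ a := abs_nonneg _
  set s := 1 - x ^ 2
  have hra : √s * a ≤ 2 * n := by
    refine abs_le_of_sq_le_sq' ?_ (by positivity) |>.2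
    rw [mul_pow, Real.sq_sqrt hs.le]; nlinarith
  have hr : (1 - x) ^ (1 / 2 : ℝ) ≤ √s := by
    rw [Real.sqrt_eq_rpow]; exact Real.rpow_le_rpow hx1.le hs1 (by norm_num)
  rw [Real.rpow_neg hx1.le, ← div_eq_mul_inv, le_div_iff₀ (by positivity)]
  calc s * a ^ 3 * (1 - x) ^ (1 / 2 : ℝ) ≤ s * a ^ 3 * √s := by gcongr
    _ = (√s * a) ^ 3 := by
      nth_rewrite 1 [← Real.sq_sqrt hs.le]; ring
    _ ≤ (2 * n) ^ 3 := by gcongr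
    _ = _ := by ring

/-- Used away from the endpoint: the Sonin bound raised to the power 3/2. The 11 is relaxed to 16 so
that 16^(3/2) = 64. -/
theorem one_sub_sq_mul_abs_derivative_legendreP_cube_le' {n : ℕ} (hn : 1 ≤ n) {x : ℝ}
    (h0 : 0 ≤ x) (h1 : x < 1) (hx : 1 / (n : ℝ) ^ 2 ≤ 1 - x) :
    (1 - x ^ 2) * |(derivative (legendreP n)).eval x| ^ 3 ≤
      64 * (n : ℝ) ^ (3 / 2 : ℝ) * (1 - x) ^ (-(5 / 4) : ℝ) := by
  have hs1 : 1 - x ≤ 1 - x ^ 2 := by nlinarith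
  have hx1 : 0 < 1 - x := by linarith
  have hs : 0 < 1 - x ^ 2 := by linarith
  have h := sqrt_mul_derivative_legendreP_sq_le hn h0 h1 (hx.trans hs1)
  have hn' : (1 : ℝ) ≤ n := by exact_mod_cast hn
  rw [← sq_abs (eval x (derivative (legendreP n)))] at h
  set a := |(derivative (legendreP n)).eval x|
  have ha : 0 ≤ a := abs_nonneg _
  set s := 1 - x ^ 2
  have h' : s ^ (3 / 2 : ℝ) * a ^ 2 ≤ 16 * n := by
    have : s ^ (3 / 2 : ℝ) = √s * s := by
      rw [Real.sqrt_eq_rpow, ← Real.rpow_add_one hs.ne']; norm_num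
    rw [this]; linarith
  have h2 := Real.rpow_le_rpow (by positivity) h' (by norm_num : (0 : ℝ) ≤ 3 / 2)
  rw [Real.mul_rpow (by positivity) (by positivity), ← Real.rpow_mul hs.le,
    ← Real.rpow_natCast a 2, ← Real.rpow_mul ha, Real.mul_rpow (by norm_num) (by positivity)] at h2
  have h16 : (16 : ℝ) ^ (3 / 2 : ℝ) = 64 := by
    rw [show (16 : ℝ) = 4 ^ (2 : ℝ) by norm_num, ← Real.rpow_mul (by norm_num)]; norm_num
  rw [h16, show ((2 : ℕ) : ℝ) * (3 / 2) = ((3 : ℕ) : ℝ) by norm_num, Real.rpow_natCast,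
    show (3 / 2 : ℝ) * (3 / 2) = 1 + 5 / 4 by norm_num, Real.rpow_add hs, Real.rpow_one] at h2
  rw [Real.rpow_neg hx1.le, ← div_eq_mul_inv, le_div_iff₀ (by positivity)]
  refine le_trans ?_ h2
  have : (1 - x) ^ (5 / 4 : ℝ) ≤ s ^ (5 / 4 : ℝ) :=
    Real.rpow_le_rpow hx1.le hs1 (by norm_num)
  calc s * a ^ 3 * (1 - x) ^ (5 / 4 : ℝ) ≤ s * a ^ 3 * s ^ (5 / 4 : ℝ) := by gcongr
    _ = _ := by ring

theorem integral_one_sub_sq_mul_abs_derivative_legendreP_cube_le {n : ℕ} (hn : 1 ≤ n) :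
    ∫ x in (0 : ℝ)..1, (1 - x ^ 2) * |(derivative (legendreP n)).eval x| ^ 3 ≤ 272 * (n : ℝ) ^ 2 := by
  have hn' : (1 : ℝ) ≤ n := by exact_mod_cast hn
  set f : ℝ → ℝ := fun x => (1 - x ^ 2) * |(derivative (legendreP n)).eval x| ^ 3 with hf
  have hfc : Continuous f := by fun_prop
  -- At distance 1/n² from the endpoint the two pointwise bounds have the same order, and each piece
  -- contributes O(n²).
  set d : ℝ := 1 / (n : ℝ) ^ 2 with hd
  have hd0 : 0 < d := by positivity
  have hd1 : d ≤ 1 := by rw [hd, div_le_one (by positivity)]; nlinarith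
  have hflip : ∫ x in (0 : ℝ)..1, f x = ∫ x in (0 : ℝ)..1, f (1 - x) := by
    have := intervalIntegral.integral_comp_sub_left (a := 0) (b := 1) f 1
    simpa only [sub_self, sub_zero] using this.symm
  have hgc : Continuous fun x => f (1 - x) := by fun_prop
  change ∫ x in (0 : ℝ)..1, f x ≤ _
  rw [hflip, ← intervalIntegral.integral_add_adjacent_intervals (b := d)
    (hgc.intervalIntegrable _ _) (hgc.intervalIntegrable _ _)]
  have A : ∫ x in (0 : ℝ)..d, f (1 - x) ≤ 16 * (n : ℝ) ^ 2 := by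
    calc _ ≤ ∫ x in (0 : ℝ)..d, 8 * (n : ℝ) ^ 3 * x ^ (-(1 / 2) : ℝ) := by
          refine intervalIntegral.integral_mono_on_of_le_Ioo hd0.le (hgc.intervalIntegrable _ _)
            ((intervalIntegral.intervalIntegrable_rpow' (by norm_num)).const_mul _) fun x hx => ?_
          have := one_sub_sq_mul_abs_derivative_legendreP_cube_le hn (x := 1 - x)
            (by linarith [hx.2]) (by linarith [hx.1])
          rwa [sub_sub_cancel] at this
      _ = 16 * (n : ℝ) ^ 2 := by
          rw [intervalIntegral.integral_const_mul, integral_rpow (Or.inl (by norm_num))]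
          have e : d ^ (-(1 / 2) + 1 : ℝ) = 1 / n := by
            rw [show (-(1 / 2) + 1 : ℝ) = 1 / 2 by norm_num, ← Real.sqrt_eq_rpow, hd,
              Real.sqrt_div zero_le_one, Real.sqrt_one, Real.sqrt_sq (by linarith)]
          rw [e, Real.zero_rpow (by norm_num)]
          field_simp; norm_num
  have B : ∫ x in d..(1 : ℝ), f (1 - x) ≤ 256 * (n : ℝ) ^ 2 := by
    have h0 : (0 : ℝ) ∉ Set.uIcc d 1 := by
      rw [Set.uIcc_of_le hd1]; intro h; linarith [h.1]
    calc _ ≤ ∫ x in d..(1 : ℝ), 64 * (n : ℝ) ^ (3 / 2 : ℝ) * x ^ (-(5 / 4) : ℝ) := by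
          refine intervalIntegral.integral_mono_on_of_le_Ioo hd1 (hgc.intervalIntegrable _ _)
            ((intervalIntegral.intervalIntegrable_rpow (Or.inr h0)).const_mul _) fun x hx => ?_
          have := one_sub_sq_mul_abs_derivative_legendreP_cube_le' hn (x := 1 - x)
            (by linarith [hx.2]) (by linarith [hx.1, hd0]) (by rw [sub_sub_cancel]; exact hx.1.le)
          rwa [sub_sub_cancel] at this
      _ ≤ 256 * (n : ℝ) ^ 2 := by
          rw [intervalIntegral.integral_const_mul, integral_rpow (Or.inr ⟨by norm_num, h0⟩)]
          have e : d ^ (-(5 / 4) + 1 : ℝ) = (n : ℝ) ^ (1 / 2 : ℝ) := by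
            rw [hd, one_div, ← Real.rpow_natCast, ← Real.rpow_neg (by positivity),
              ← Real.rpow_mul (by positivity)]
            norm_num
          rw [e, Real.one_rpow]
          have e2 : (n : ℝ) ^ (3 / 2 : ℝ) * (n : ℝ) ^ (1 / 2 : ℝ) = (n : ℝ) ^ 2 := by
            rw [← Real.rpow_add (by positivity)]; norm_num
          have e3 : 0 ≤ (n : ℝ) ^ (3 / 2 : ℝ) := by positivity
          norm_num
          nlinarith
  linarith

theorem abs_integral_legendreP_cube_le {n : ℕ} (hn : 1 ≤ n) :
    |∫ x in (-1 : ℝ)..1, (legendreP n).eval x ^ 3| ≤ 800 / n ^ 2 := by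
  have hn' : (1 : ℝ) ≤ n := by exact_mod_cast hn
  have h := integral_legendreP_cube_eq n
  have h1 : |∫ x in (-1 : ℝ)..1, x * ((1 - x ^ 2) * (derivative (legendreP n)).eval x ^ 3)| ≤
      ∫ x in (-1 : ℝ)..1, (1 - x ^ 2) * |(derivative (legendreP n)).eval x| ^ 3 := by
    rw [← Real.norm_eq_abs]
    refine intervalIntegral.norm_integral_le_of_norm_le (by norm_num) ?_
      (Continuous.intervalIntegrable (by fun_prop) _ _)
    refine Filter.Eventually.of_forall fun x hx => ?_
    have hs : 0 ≤ 1 - x ^ 2 := by nlinarith [hx.1, hx.2]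
    have hx1 : |x| ≤ 1 := abs_le.mpr ⟨hx.1.le, hx.2⟩
    rw [Real.norm_eq_abs, abs_mul, abs_mul, abs_pow, abs_of_nonneg hs]
    exact mul_le_of_le_one_left (by positivity) hx1
  rw [integral_eq_two_mul_integral_of_even
    (f := fun x => (1 - x ^ 2) * |(derivative (legendreP n)).eval x| ^ 3) (by fun_prop)
    (fun x => by rw [abs_derivative_legendreP_neg, neg_sq])] at h1
  have h2 := integral_one_sub_sq_mul_abs_derivative_legendreP_cube_le hn
  have h3 := congrArg abs h
  rw [abs_mul, abs_of_nonneg (by positivity : (0 : ℝ) ≤ 3 * ((n : ℝ) * (n + 1)) ^ 2),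
    abs_mul 4, abs_of_pos (by norm_num : (0 : ℝ) < 4)] at h3
  set I := |∫ x in (-1 : ℝ)..1, (legendreP n).eval x ^ 3|
  have hI : 0 ≤ I := abs_nonneg _
  rw [le_div_iff₀ (by positivity)]
  -- 2176 = 4 · 2 · 272, the 2 coming from evenness; 2176/3 < 800.
  have h4 : 3 * (n : ℝ) ^ 4 * I ≤ 2176 * n ^ 2 := by
    calc 3 * (n : ℝ) ^ 4 * I ≤ 3 * ((n : ℝ) * (n + 1)) ^ 2 * I := by
          gcongr
          calc (n : ℝ) ^ 4 = (n * n) ^ 2 := by ring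
            _ ≤ _ := by gcongr; linarith
      _ ≤ _ := by rw [h3]; linarith
  have h5 : (n : ℝ) ^ 2 * (I * n ^ 2) ≤ n ^ 2 * 800 := by nlinarith [sq_nonneg (n : ℝ)]
  exact le_of_mul_le_mul_left h5 (by positivity)

/-! ### Moments of the surface measure through Gaussian integrals. -/

/-- The `n`-th moment of the Gaussian weight `exp (-x ^ 2)`. -/
noncomputable def gaussMoment (n : ℕ) : ℝ := ∫ x : ℝ, x ^ n * Real.exp (-x ^ 2)

theorem integrable_pow_mul_exp_neg_sq (n : ℕ) :
    Integrable fun x : ℝ => x ^ n * Real.exp (-x ^ 2) := by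
  have := integrable_rpow_mul_exp_neg_mul_sq (b := 1) one_pos (s := n)
    (by linarith [(n.cast_nonneg : (0 : ℝ) ≤ n)])
  simpa using this

theorem gaussMoment_one : gaussMoment 1 = 0 := by
  have hd : ∀ x : ℝ, HasDerivAt (fun x : ℝ => Real.exp (-x ^ 2))
      (-2 * (x ^ 1 * Real.exp (-x ^ 2))) x := fun x => by
    convert! ((hasDerivAt_pow 2 x).neg).exp using 1
    simp; ring
  have := integral_eq_zero_of_hasDerivAt_of_integrable hd
    ((integrable_pow_mul_exp_neg_sq 1).const_mul _)
    (by simpa using integrable_pow_mul_exp_neg_sq 0)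
  rw [integral_const_mul] at this
  simpa [gaussMoment] using this

theorem gaussMoment_add_two (n : ℕ) : 2 * gaussMoment (n + 2) = (n + 1) * gaussMoment n := by
  have hd : ∀ x : ℝ, HasDerivAt (fun x : ℝ => x ^ (n + 1) * Real.exp (-x ^ 2))
      ((n + 1) * (x ^ n * Real.exp (-x ^ 2)) - 2 * (x ^ (n + 2) * Real.exp (-x ^ 2))) x :=
    fun x => by
      convert! (hasDerivAt_pow (n + 1) x).mul (((hasDerivAt_pow 2 x).neg).exp) using 1
      simp; ring
  have := integral_eq_zero_of_hasDerivAt_of_integrable hd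
    (((integrable_pow_mul_exp_neg_sq n).const_mul _).sub
      ((integrable_pow_mul_exp_neg_sq (n + 2)).const_mul _))
    (integrable_pow_mul_exp_neg_sq (n + 1))
  rw [integral_sub ((integrable_pow_mul_exp_neg_sq n).const_mul _)
      ((integrable_pow_mul_exp_neg_sq (n + 2)).const_mul _), integral_const_mul,
      integral_const_mul] at this
  simp only [gaussMoment]
  linarith

instance : IsFiniteMeasure sigmaS2 := by unfold sigmaS2; infer_instance

/-- The radial factor in the polar decomposition of Gaussian moments of degree `m` on `ℝ³`. -/
noncomputable def radialMoment (m : ℕ) : ℝ :=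
  ∫ r : Set.Ioi (0 : ℝ), (r : ℝ) ^ m * Real.exp (-(r : ℝ) ^ 2) ∂(Measure.volumeIoiPow 2)

theorem radialMoment_ne_zero (m : ℕ) : radialMoment m ≠ 0 := by
  have h : radialMoment m = ∫ r in Set.Ioi (0 : ℝ), r ^ (m + 2) * Real.exp (-r ^ 2) := by
    simp only [radialMoment, Measure.volumeIoiPow, ENNReal.ofReal]
    rw [integral_withDensity_eq_integral_smul,
        integral_subtype_comap measurableSet_Ioi
          fun a : ℝ => Real.toNNReal (a ^ 2) • (a ^ m * Real.exp (-a ^ 2)),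
        setIntegral_congr_fun measurableSet_Ioi fun x hx => ?_]
    · simp only [NNReal.smul_def, Real.coe_toNNReal _ (sq_nonneg _), smul_eq_mul]; ring
    · exact (measurable_subtype_coe.pow_const _).real_toNNReal
  have h2 := integral_rpow_mul_exp_neg_rpow (p := 2) (q := (m + 2 : ℕ)) two_pos
    (by linarith [((m + 2).cast_nonneg : (0 : ℝ) ≤ (m + 2 : ℕ))])
  simp only [Real.rpow_natCast, Real.rpow_ofNat] at h2
  rw [h, h2]
  have := Real.Gamma_pos_of_pos (s := (((m + 2 : ℕ) : ℝ) + 1) / 2) (by positivity)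
  positivity

/-- Polar coordinates: homogeneity separates the radius from the direction. -/
theorem integral_homogeneous_mul_exp (m : ℕ) (M : EuclideanSpace ℝ (Fin 3) → ℝ)
    (hM : ∀ (r : ℝ) (x), M (r • x) = r ^ m * M x) :
    ∫ x, M x * Real.exp (-‖x‖ ^ 2) = (∫ y : S2, M y ∂sigmaS2) * radialMoment m := by
  have hmp := (volume : Measure (EuclideanSpace ℝ (Fin 3))).measurePreserving_homeomorphUnitSphereProd
  rw [finrank_euclideanSpace_fin] at hmp
  calc ∫ x, M x * Real.exp (-‖x‖ ^ 2)
      = ∫ x : ({(0)}ᶜ : Set (EuclideanSpace ℝ (Fin 3))), M x.1 * Real.exp (-‖x.1‖ ^ 2)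
          ∂(volume.comap Subtype.val) := by
        rw [integral_subtype_comap (measurableSet_singleton _).compl
          fun x => M x * Real.exp (-‖x‖ ^ 2), restrict_compl_singleton]
    _ = ∫ z : S2 × Set.Ioi (0 : ℝ), M z.1 * ((z.2 : ℝ) ^ m * Real.exp (-(z.2 : ℝ) ^ 2))
          ∂sigmaS2.prod (.volumeIoiPow 2) := by
        rw [sigmaS2, ← hmp.integral_comp (Homeomorph.measurableEmbedding _)]
        refine integral_congr_ae (Filter.Eventually.of_forall fun x => ?_)
        have hx : ‖x.1‖ ≠ 0 := norm_ne_zero_iff.mpr x.2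
        have : M x.1 = ‖x.1‖ ^ m * M (‖x.1‖⁻¹ • x.1) := by
          rw [← hM, smul_inv_smul₀ hx]
        simp only [homeomorphUnitSphereProd_apply_fst_coe, homeomorphUnitSphereProd_apply_snd_coe]
        rw [this]; ring
    _ = _ := by
        rw [radialMoment]
        exact integral_prod_mul (fun y : S2 => M y)
          (fun r : Set.Ioi (0 : ℝ) => (r : ℝ) ^ m * Real.exp (-(r : ℝ) ^ 2))

theorem integral_prod_inner_pow_mul_exp (b : OrthonormalBasis (Fin 3) ℝ (EuclideanSpace ℝ (Fin 3)))
    (e : Fin 3 → ℕ) :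
    ∫ x, (∏ i, inner ℝ (b i) x ^ e i) * Real.exp (-‖x‖ ^ 2) = ∏ i, gaussMoment (e i) := by
  have h1 := b.measurePreserving_repr.integral_comp b.repr.toHomeomorph.measurableEmbedding
    (fun v => (∏ i, v i ^ e i) * Real.exp (-‖v‖ ^ 2))
  have h2 := (PiLp.volume_preserving_toLp (Fin 3)).integral_comp
    (MeasurableEquiv.toLp 2 _).measurableEmbedding
    (fun v : EuclideanSpace ℝ (Fin 3) => (∏ i, v i ^ e i) * Real.exp (-‖v‖ ^ 2))
  have h3 : ∫ x, (∏ i, inner ℝ (b i) x ^ e i) * Real.exp (-‖x‖ ^ 2) =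
      ∫ x, (∏ i, b.repr x i ^ e i) * Real.exp (-‖b.repr x‖ ^ 2) := by
    simp [b.repr_apply_apply]
  rw [h3, h1, ← h2]
  simp only [gaussMoment]
  rw [← integral_fintype_prod_volume_eq_prod (fun i (x : ℝ) => x ^ e i * Real.exp (-x ^ 2))]
  refine integral_congr_ae (Filter.Eventually.of_forall fun v => ?_)
  simp only [EuclideanSpace.real_norm_sq_eq, Finset.prod_mul_distrib, ← Real.exp_sum,
    Finset.sum_neg_distrib]

/-- Moments of the surface measure with respect to an orthonormal frame. -/
noncomputable def sphereMoment (b : OrthonormalBasis (Fin 3) ℝ (EuclideanSpace ℝ (Fin 3)))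
    (i j k : ℕ) : ℝ :=
  ∫ y : S2, inner ℝ (b 0) (y : EuclideanSpace ℝ (Fin 3)) ^ i * inner ℝ (b 1) (y : EuclideanSpace ℝ (Fin 3)) ^ j *
    inner ℝ (b 2) (y : EuclideanSpace ℝ (Fin 3)) ^ k ∂sigmaS2

theorem sphereMoment_mul_radialMoment
    (b : OrthonormalBasis (Fin 3) ℝ (EuclideanSpace ℝ (Fin 3))) (i j k : ℕ) :
    sphereMoment b i j k * radialMoment (i + j + k) =
      gaussMoment i * gaussMoment j * gaussMoment k := by
  have h1 := integral_prod_inner_pow_mul_exp b ![i, j, k]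
  have h2 := integral_homogeneous_mul_exp (i + j + k)
    (fun x => ∏ l, inner ℝ (b l) x ^ (![i, j, k] : Fin 3 → ℕ) l) (fun r x => by
      simp [Fin.prod_univ_three, inner_smul_right, mul_pow, pow_add]; ring)
  rw [h1] at h2
  simp only [Fin.prod_univ_three, Matrix.cons_val_zero, Matrix.cons_val_one, Matrix.cons_val] at h2
  exact h2.symm

theorem continuous_integrable_S2 {f : S2 → ℝ} (hf : Continuous f) : Integrable f sigmaS2 :=
  hf.integrable_of_hasCompactSupport (HasCompactSupport.of_compactSpace f)

theorem sum_inner_sq_eq_one (b : OrthonormalBasis (Fin 3) ℝ (EuclideanSpace ℝ (Fin 3))) (y : S2) :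
    inner ℝ (b 0) (y : EuclideanSpace ℝ (Fin 3)) ^ 2 + inner ℝ (b 1) (y : EuclideanSpace ℝ (Fin 3)) ^ 2 +
    inner ℝ (b 2) (y : EuclideanSpace ℝ (Fin 3)) ^ 2 = 1 := by
  have h := b.sum_sq_norm_inner_right (y : EuclideanSpace ℝ (Fin 3))
  simpa [Fin.sum_univ_three] using h

theorem sphereMoment_two (b : OrthonormalBasis (Fin 3) ℝ (EuclideanSpace ℝ (Fin 3))) (i j : ℕ) :
    sphereMoment b i j 2 =
      sphereMoment b i j 0 - sphereMoment b (i + 2) j 0 - sphereMoment b i (j + 2) 0 := by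
  simp only [sphereMoment]
  rw [← integral_sub, ← integral_sub]
  · refine integral_congr_ae (Filter.Eventually.of_forall fun y => ?_)
    have := sum_inner_sq_eq_one b y
    simp only [pow_zero, mul_one]
    linear_combination (inner ℝ (b 0) (y : EuclideanSpace ℝ (Fin 3)) ^ i *
      inner ℝ (b 1) (y : EuclideanSpace ℝ (Fin 3)) ^ j) * this
  all_goals exact continuous_integrable_S2 (by fun_prop)

/-- The moments (i, j+2, 0) and (i, j, 2) have equal total degree, hence the same radial factor, and
their ratio j + 1 is read off from Gaussian moments. The third coordinate is then eliminated by |y|²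
= 1. -/
theorem sphereMoment_second_add_two (b : OrthonormalBasis (Fin 3) ℝ (EuclideanSpace ℝ (Fin 3)))
    (i j : ℕ) : (j + 2) * sphereMoment b i (j + 2) 0 =
      (j + 1) * (sphereMoment b i j 0 - sphereMoment b (i + 2) j 0) := by
  have h1 := sphereMoment_mul_radialMoment b i (j + 2) 0
  have h2 := sphereMoment_mul_radialMoment b i j 2
  have hR := radialMoment_ne_zero (i + j + 2)
  have g0 := gaussMoment_add_two 0
  have gj := gaussMoment_add_two j
  rw [show i + (j + 2) + 0 = i + j + 2 by ring] at h1
  have : sphereMoment b i (j + 2) 0 = (j + 1) * sphereMoment b i j 2 := by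
    apply mul_right_cancel₀ hR
    rw [h1, mul_assoc (_ + 1 : ℝ), h2]
    norm_num at g0
    linear_combination (gaussMoment i * gaussMoment 0 / 2) * gj - (j + 1) * gaussMoment i * gaussMoment j / 2 * g0
  have h3 := sphereMoment_two b i j
  linear_combination this + (j + 1) * h3

theorem sphereMoment_first_add_two (b : OrthonormalBasis (Fin 3) ℝ (EuclideanSpace ℝ (Fin 3)))
    (i : ℕ) : (i + 3) * sphereMoment b (i + 2) 0 0 = (i + 1) * sphereMoment b i 0 0 := by
  have h1 := sphereMoment_mul_radialMoment b (i + 2) 0 0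
  have h2 := sphereMoment_mul_radialMoment b i 2 0
  have hR := radialMoment_ne_zero (i + 2)
  have g0 := gaussMoment_add_two 0
  have gj := gaussMoment_add_two i
  have : sphereMoment b (i + 2) 0 0 = (i + 1) * sphereMoment b i 2 0 := by
    apply mul_right_cancel₀ hR
    simp only [add_zero] at h1 h2
    rw [h1, mul_assoc (_ + 1 : ℝ), h2]
    norm_num at g0
    linear_combination (gaussMoment 0 * gaussMoment 0 / 2) * gj - (i + 1) * gaussMoment i * gaussMoment 0 / 2 * g0
  have h3 := sphereMoment_second_add_two b i 0
  norm_num at h3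
  linear_combination 2 * this + (i + 1) * h3

theorem sphereMoment_second_one (b : OrthonormalBasis (Fin 3) ℝ (EuclideanSpace ℝ (Fin 3)))
    (i : ℕ) : sphereMoment b i 1 0 = 0 := by
  have h1 := sphereMoment_mul_radialMoment b i 1 0
  rw [gaussMoment_one, mul_zero, zero_mul] at h1
  exact (mul_eq_zero.mp h1).resolve_right (radialMoment_ne_zero _)

theorem sphereMoment_first_one (b : OrthonormalBasis (Fin 3) ℝ (EuclideanSpace ℝ (Fin 3))) :
    sphereMoment b 1 0 0 = 0 := by
  have h1 := sphereMoment_mul_radialMoment b 1 0 0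
  rw [gaussMoment_one, zero_mul, zero_mul] at h1
  exact (mul_eq_zero.mp h1).resolve_right (radialMoment_ne_zero _)

/-- Half of the total mass of the sphere. -/
noncomputable def halfMass : ℝ := sigmaS2.real Set.univ / 2

/-- Only positivity of the mass is ever used, never its value. -/
theorem halfMass_pos : 0 < halfMass := by
  have : sigmaS2 ≠ 0 := by
    unfold sigmaS2; exact Measure.toSphere_ne_zero _
  have h : 0 < sigmaS2.real Set.univ := by
    rw [measureReal_def]
    exact ENNReal.toReal_pos (by simpa using this) (measure_ne_top _ _)
  unfold halfMass; positivity

/-- Archimedes' theorem for monomials: both sides satisfy (i+3) a_(i+2) = (i+1) a_i and agree for i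
= 0, 1. -/
theorem sphereMoment_eq_integral (b : OrthonormalBasis (Fin 3) ℝ (EuclideanSpace ℝ (Fin 3)))
    (i : ℕ) : sphereMoment b i 0 0 = halfMass * ∫ t in (-1 : ℝ)..1, t ^ i := by
  have hI : ∀ i : ℕ, ∫ t in (-1 : ℝ)..1, t ^ i = (1 - (-1) ^ (i + 1)) / (i + 1) := by
    intro i; rw [integral_pow]; simp
  induction i using Nat.twoStepInduction with
  | zero => simp [sphereMoment, halfMass]; ring
  | one => rw [sphereMoment_first_one, hI]; norm_num
  | more i ih _ =>
    have h := sphereMoment_first_add_two b i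
    rw [ih, hI] at h
    rw [hI]
    have h3 : (i : ℝ) + 3 ≠ 0 := by positivity
    have h1 : (i : ℝ) + 1 ≠ 0 := by positivity
    apply mul_left_cancel₀ h3
    rw [h]
    push_cast
    have h4 : (i : ℝ) + 2 + 1 ≠ 0 := by positivity
    field_simp
    ring

/-! ### Zonal integrals: Archimedes and Funk–Hecke. -/

/-- The inner product of two points of the sphere. -/
noncomputable def sdot (x y : S2) : ℝ :=
  inner ℝ (x : EuclideanSpace ℝ (Fin 3)) (y : EuclideanSpace ℝ (Fin 3))

theorem sdot_comm (x y : S2) : sdot x y = sdot y x := real_inner_comm _ _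

theorem sdot_self (x : S2) : sdot x x = 1 := by
  rw [sdot, real_inner_self_eq_norm_sq]; simp

@[fun_prop]
theorem continuous_sdot {α : Type*} [TopologicalSpace α] {f g : α → S2} (hf : Continuous f)
    (hg : Continuous g) : Continuous fun a => sdot (f a) (g a) := by
  unfold sdot; fun_prop

theorem sdot_mem_Icc (x y : S2) : sdot x y ∈ Set.Icc (-1 : ℝ) 1 := by
  have := abs_real_inner_le_norm (x : EuclideanSpace ℝ (Fin 3)) (y : EuclideanSpace ℝ (Fin 3))
  simp only [norm_eq_of_mem_sphere, mul_one] at this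
  exact abs_le.mp this

theorem integral_eval_mul_pow_add_two
    (b : OrthonormalBasis (Fin 3) ℝ (EuclideanSpace ℝ (Fin 3))) (p : ℝ[X]) (j : ℕ) :
    (j + 2) * ∫ y : S2, p.eval (inner ℝ (b 0) (y : EuclideanSpace ℝ (Fin 3))) *
        inner ℝ (b 1) (y : EuclideanSpace ℝ (Fin 3)) ^ (j + 2) ∂sigmaS2 =
      (j + 1) * ∫ y : S2, (p * (1 - X ^ 2)).eval (inner ℝ (b 0) (y : EuclideanSpace ℝ (Fin 3))) *
        inner ℝ (b 1) (y : EuclideanSpace ℝ (Fin 3)) ^ j ∂sigmaS2 := by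
  induction p using Polynomial.induction_on' with
  | add p q hp hq =>
    simp only [eval_add, add_mul]
    rw [integral_add, integral_add]
    · linear_combination hp + hq
    all_goals exact continuous_integrable_S2 (by fun_prop)
  | monomial i a =>
    have h := sphereMoment_second_add_two b i j
    simp only [sphereMoment, pow_zero, mul_one] at h
    rw [← integral_sub] at h
    · simp only [eval_monomial, eval_mul, eval_sub, eval_one, eval_pow, eval_X, mul_assoc]
      rw [integral_const_mul, integral_const_mul]
      have e : ∀ y : S2, inner ℝ (b 0) (y : EuclideanSpace ℝ (Fin 3)) ^ i *
          ((1 - inner ℝ (b 0) (y : EuclideanSpace ℝ (Fin 3)) ^ 2) *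
            inner ℝ (b 1) (y : EuclideanSpace ℝ (Fin 3)) ^ j) =
          inner ℝ (b 0) (y : EuclideanSpace ℝ (Fin 3)) ^ i *
            inner ℝ (b 1) (y : EuclideanSpace ℝ (Fin 3)) ^ j -
          inner ℝ (b 0) (y : EuclideanSpace ℝ (Fin 3)) ^ (i + 2) *
            inner ℝ (b 1) (y : EuclideanSpace ℝ (Fin 3)) ^ j := fun y => by ring
      simp_rw [e]
      linear_combination a * h
    all_goals exact continuous_integrable_S2 (by fun_prop)

theorem integral_eval_mul_odd
    (b : OrthonormalBasis (Fin 3) ℝ (EuclideanSpace ℝ (Fin 3))) (p : ℝ[X]) :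
    ∫ y : S2, p.eval (inner ℝ (b 0) (y : EuclideanSpace ℝ (Fin 3))) *
        inner ℝ (b 1) (y : EuclideanSpace ℝ (Fin 3)) ^ 1 ∂sigmaS2 = 0 := by
  induction p using Polynomial.induction_on' with
  | add p q hp hq =>
    simp only [eval_add, add_mul]
    rw [integral_add, hp, hq, add_zero]
    all_goals exact continuous_integrable_S2 (by fun_prop)
  | monomial i a =>
    have h := sphereMoment_second_one b i
    simp only [sphereMoment, pow_zero, mul_one] at h
    simp only [eval_monomial, mul_assoc]
    rw [integral_const_mul, h, mul_zero]

theorem integral_eval_frame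
    (b : OrthonormalBasis (Fin 3) ℝ (EuclideanSpace ℝ (Fin 3))) (p : ℝ[X]) :
    ∫ y : S2, p.eval (inner ℝ (b 0) (y : EuclideanSpace ℝ (Fin 3))) ∂sigmaS2 =
      halfMass * ∫ t in (-1 : ℝ)..1, p.eval t := by
  induction p using Polynomial.induction_on' with
  | add p q hp hq =>
    simp only [eval_add]
    rw [integral_add, intervalIntegral.integral_add, hp, hq, mul_add]
    any_goals exact continuous_integrable_S2 (by fun_prop)
    all_goals exact Continuous.intervalIntegrable (by fun_prop) _ _
  | monomial i a =>
    have h := sphereMoment_eq_integral b i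
    simp only [sphereMoment, pow_zero, mul_one] at h
    simp only [eval_monomial]
    rw [integral_const_mul, intervalIntegral.integral_const_mul, h]
    ring

/-- Normalised moments of one coordinate of the unit circle. -/
noncomputable def circleMoment : ℕ → ℝ
  | 0 => 1
  | 1 => 0
  | j + 2 => (j + 1) / (j + 2) * circleMoment j

theorem circleMoment_odd (i : ℕ) : circleMoment (2 * i + 1) = 0 := by
  induction i with
  | zero => rfl
  | succ i ih =>
    rw [show 2 * (i + 1) + 1 = (2 * i + 1) + 2 by ring, circleMoment, ih, mul_zero]

/-- Given a first coordinate t, the second is √(1-t²) times a coordinate on the unit circle. The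
rounding in `j / 2` is harmless, since odd circle moments vanish. -/
theorem integral_eval_mul_pow
    (b : OrthonormalBasis (Fin 3) ℝ (EuclideanSpace ℝ (Fin 3))) (p : ℝ[X]) (j : ℕ) :
    ∫ y : S2, p.eval (inner ℝ (b 0) (y : EuclideanSpace ℝ (Fin 3))) *
        inner ℝ (b 1) (y : EuclideanSpace ℝ (Fin 3)) ^ j ∂sigmaS2 =
      circleMoment j * (halfMass * ∫ t in (-1 : ℝ)..1, (p * (1 - X ^ 2) ^ (j / 2)).eval t) := by
  induction j using Nat.twoStepInduction generalizing p with
  | zero => simpa [circleMoment] using integral_eval_frame b p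
  | one => rw [integral_eval_mul_odd, circleMoment, zero_mul]
  | more j ih _ =>
    have h := integral_eval_mul_pow_add_two b p j
    have hj : (j : ℝ) + 2 ≠ 0 := by positivity
    rw [ih] at h
    apply mul_left_cancel₀ hj
    rw [h, circleMoment, show (j + 2) / 2 = j / 2 + 1 by omega, pow_succ' (1 - X ^ 2 : ℝ[X]),
      ← mul_assoc p]
    field_simp

theorem exists_frame (x z : S2) :
    ∃ (b : OrthonormalBasis (Fin 3) ℝ (EuclideanSpace ℝ (Fin 3))) (β : ℝ),
      b 0 = z ∧ (x : EuclideanSpace ℝ (Fin 3)) = sdot z x • b 0 + β • b 1 ∧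
      β ^ 2 = 1 - sdot z x ^ 2 := by
  have hz : ‖(z : EuclideanSpace ℝ (Fin 3))‖ = 1 := norm_eq_of_mem_sphere z
  have hx : ‖(x : EuclideanSpace ℝ (Fin 3))‖ = 1 := norm_eq_of_mem_sphere x
  set w : EuclideanSpace ℝ (Fin 3) := x - sdot z x • (z : EuclideanSpace ℝ (Fin 3)) with hw
  have hzw : inner ℝ (z : EuclideanSpace ℝ (Fin 3)) w = 0 := by
    rw [hw, inner_sub_right, inner_smul_right, real_inner_self_eq_norm_sq, hz, sdot]; simp
  have hww : ‖w‖ ^ 2 = 1 - sdot z x ^ 2 := by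
    rw [hw, norm_sub_sq_real, norm_smul, inner_smul_right, real_inner_comm, hx, hz,
      ← sdot.eq_def, Real.norm_eq_abs, mul_one, sq_abs]
    ring
  have hcard : Module.finrank ℝ (EuclideanSpace ℝ (Fin 3)) = Fintype.card (Fin 3) := by simp
  -- Here x = ±z: the second axis is arbitrary and β = 0.
  by_cases h0 : w = 0
  · have ho : Orthonormal ℝ (({0} : Set (Fin 3)).domRestrict
        (fun _ => (z : EuclideanSpace ℝ (Fin 3)))) := by
      constructor
      · intro i; simp
      · intro i j hij
        exact absurd (Subsingleton.elim i j) hij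
    obtain ⟨b, hb⟩ := ho.exists_orthonormalBasis_extension_of_card_eq hcard
    refine ⟨b, 0, hb 0 rfl, ?_, ?_⟩
    · rw [hb 0 rfl, zero_smul, add_zero]; exact sub_eq_zero.mp h0
    · rw [← hww, h0]; simp
  · have hn : ‖w‖ ≠ 0 := norm_ne_zero_iff.mpr h0
    have ho : Orthonormal ℝ (({0, 1} : Set (Fin 3)).domRestrict
        (![(z : EuclideanSpace ℝ (Fin 3)), ‖w‖⁻¹ • w, 0])) := by
      constructor
      · rintro ⟨i, rfl | rfl⟩
        · simp
        · simp [norm_smul, hn]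
      · rintro ⟨i, rfl | rfl⟩ ⟨j, rfl | rfl⟩ hij
        · exact absurd rfl hij
        · simp [inner_smul_right, hzw]
        · simp [inner_smul_left, real_inner_comm, hzw]
        · exact absurd rfl hij
    obtain ⟨b, hb⟩ := ho.exists_orthonormalBasis_extension_of_card_eq hcard
    have hb0 : b 0 = z := by simpa using hb 0 (by simp)
    have hb1 : b 1 = ‖w‖⁻¹ • w := by simpa using hb 1 (by simp)
    refine ⟨b, ‖w‖, hb0, ?_, hww⟩
    rw [hb0, hb1, smul_inv_smul₀ hn, hw]; simp

theorem integral_eval_sdot_eq (p : ℝ[X]) (z : S2) :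
    ∫ y : S2, p.eval (sdot z y) ∂sigmaS2 = halfMass * ∫ t in (-1 : ℝ)..1, p.eval t := by
  obtain ⟨b, -, hb, -, -⟩ := exists_frame z z
  have := integral_eval_frame b p
  rw [hb] at this
  exact this

/-- Archimedes' theorem: a coordinate of a uniform point of the sphere is uniform. -/
theorem integral_comp_sdot {f : ℝ → ℝ} (hf : Continuous f) (z : S2) :
    ∫ y : S2, f (sdot z y) ∂sigmaS2 = halfMass * ∫ t in (-1 : ℝ)..1, f t := by
  have hA := halfMass_pos
  have hmass : sigmaS2.real Set.univ = 2 * halfMass := by unfold halfMass; ring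
  by_contra hne
  set d := |(∫ y : S2, f (sdot z y) ∂sigmaS2) - halfMass * ∫ t in (-1 : ℝ)..1, f t| with hd
  have hdpos : 0 < d := abs_pos.mpr (sub_ne_zero.mpr hne)
  -- Weierstrass approximation; the tolerance makes each of the two errors d/4, so d ≤ d/2.
  obtain ⟨p, hp⟩ := exists_polynomial_near_of_continuousOn (-1) 1 f hf.continuousOn
    (d / (8 * halfMass)) (by positivity)
  have h1 : |(∫ y : S2, f (sdot z y) ∂sigmaS2) - ∫ y : S2, p.eval (sdot z y) ∂sigmaS2| ≤ d / 4 := by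
    rw [← integral_sub (continuous_integrable_S2 (by fun_prop))
      (continuous_integrable_S2 (by fun_prop)), ← Real.norm_eq_abs]
    refine (norm_integral_le_of_norm_le_const (C := d / (8 * halfMass))
      (Filter.Eventually.of_forall fun y => ?_)).trans ?_
    · rw [Real.norm_eq_abs, abs_sub_comm]; exact (hp _ (sdot_mem_Icc z y)).le
    · rw [hmass]; apply le_of_eq; field_simp; norm_num
  have h2 : |(∫ t in (-1 : ℝ)..1, p.eval t) - ∫ t in (-1 : ℝ)..1, f t| ≤
      d / (4 * halfMass) := by
    rw [← intervalIntegral.integral_sub (Continuous.intervalIntegrable (by fun_prop) _ _)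
      (hf.intervalIntegrable _ _), ← Real.norm_eq_abs]
    refine (intervalIntegral.norm_integral_le_of_norm_le_const (C := d / (8 * halfMass))
      fun t ht => ?_).trans ?_
    · rw [Set.uIoc_of_le (by norm_num)] at ht
      exact (hp t ⟨ht.1.le, ht.2⟩).le
    · apply le_of_eq; field_simp; norm_num
  have h3 : d ≤ d / 4 + halfMass * (d / (4 * halfMass)) := by
    rw [integral_eval_sdot_eq] at h1
    calc d = |((∫ y : S2, f (sdot z y) ∂sigmaS2) - halfMass * ∫ t in (-1 : ℝ)..1, p.eval t) +
          halfMass * ((∫ t in (-1 : ℝ)..1, p.eval t) - ∫ t in (-1 : ℝ)..1, f t)| := by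
          rw [hd]; congr 1; ring
      _ ≤ _ := by
          refine (abs_add_le _ _).trans (add_le_add h1 ?_)
          rw [abs_mul, abs_of_pos hA]
          exact mul_le_mul_of_nonneg_left h2 hA.le
  have h4 : halfMass * (d / (4 * halfMass)) = d / 4 := by field_simp
  linarith

/-- The Funk–Hecke type expansion of the zonal convolution of a polynomial with a monomial. -/
theorem integral_eval_sdot_mul_sdot_pow (p : ℝ[X]) (k : ℕ) (x z : S2) :
    ∫ y : S2, p.eval (sdot z y) * sdot x y ^ k ∂sigmaS2 =
      ∑ j ∈ Finset.range (k + 1), circleMoment j * (k.choose j) *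
        (halfMass * ∫ t in (-1 : ℝ)..1, (p * (X ^ (k - j) * (1 - X ^ 2) ^ (j / 2))).eval t) *
        ((1 - X ^ 2) ^ (j / 2) * X ^ (k - j) : ℝ[X]).eval (sdot z x) := by
  obtain ⟨b, β, hb, hx, hβ⟩ := exists_frame x z
  have e : ∀ y : S2, p.eval (sdot z y) * sdot x y ^ k =
      ∑ j ∈ Finset.range (k + 1), (β ^ j * sdot z x ^ (k - j) * (k.choose j)) *
        ((p * X ^ (k - j)).eval (inner ℝ (b 0) (y : EuclideanSpace ℝ (Fin 3))) *
        inner ℝ (b 1) (y : EuclideanSpace ℝ (Fin 3)) ^ j) := by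
    intro y
    have h1 : sdot x y = β * inner ℝ (b 1) (y : EuclideanSpace ℝ (Fin 3)) +
        sdot z x * inner ℝ (b 0) (y : EuclideanSpace ℝ (Fin 3)) := by
      conv_lhs => rw [sdot, hx]
      rw [inner_add_left, real_inner_smul_left, real_inner_smul_left, add_comm]
    rw [h1, add_pow, Finset.mul_sum]
    refine Finset.sum_congr rfl fun j _ => ?_
    rw [hb]
    simp only [eval_mul, eval_pow, eval_X, mul_pow, sdot]
    ring
  simp_rw [e]
  rw [integral_finsetSum _ fun j _ => continuous_integrable_S2 (by fun_prop)]
  refine Finset.sum_congr rfl fun j _ => ?_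
  rw [integral_const_mul, integral_eval_mul_pow]
  -- Only even j survive, so the powers of β become powers of 1 - `sdot z x`² and the result is a
  -- polynomial in `sdot z x`.
  obtain ⟨i, rfl | rfl⟩ := Nat.even_or_odd' j
  · rw [show 2 * i / 2 = i by omega, pow_mul, hβ]
    simp only [eval_mul, eval_pow, eval_X, eval_sub, eval_one, mul_assoc]
    ring
  · rw [circleMoment_odd]; ring

theorem natDegree_one_sub_sq_pow_mul_le {k j : ℕ} (hj : j ≤ k) :
    ((1 - X ^ 2) ^ (j / 2) * X ^ (k - j) : ℝ[X]).natDegree ≤ k := by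
  have h1 : ((1 - X ^ 2 : ℝ[X]) ^ (j / 2)).natDegree ≤ (j / 2) * 2 :=
    natDegree_pow_le_of_le _ (by compute_degree)
  refine natDegree_mul_le.trans ?_
  rw [natDegree_X_pow]
  omega

theorem integral_legendreP_sdot_mul_sdot_pow_eq_zero {n k : ℕ} (hk : k < n) (x z : S2) :
    ∫ y : S2, (legendreP n).eval (sdot z y) * sdot x y ^ k ∂sigmaS2 = 0 := by
  rw [integral_eval_sdot_mul_sdot_pow]
  refine Finset.sum_eq_zero fun j hj => ?_
  have hd : (X ^ (k - j) * (1 - X ^ 2) ^ (j / 2) : ℝ[X]).degree < n := by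
    rw [mul_comm]
    refine degree_le_natDegree.trans_lt ?_
    exact_mod_cast (natDegree_one_sub_sq_pow_mul_le
      (Nat.lt_succ_iff.mp (Finset.mem_range.mp hj))).trans_lt hk
  have := integral_legendreP_mul_eq_zero hd
  simp only [eval_mul] at this ⊢
  rw [this]; ring

theorem exists_eval_sdot_eq_integral (p q : ℝ[X]) {n : ℕ} (hq : q.natDegree ≤ n) :
    ∃ g : ℝ[X], g.natDegree ≤ n ∧
      ∀ x z : S2, ∫ y : S2, p.eval (sdot z y) * q.eval (sdot x y) ∂sigmaS2 = g.eval (sdot z x) := by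
  refine ⟨∑ k ∈ Finset.range (n + 1), C (q.coeff k) *
    ∑ j ∈ Finset.range (k + 1), C (circleMoment j * (k.choose j) *
        (halfMass * ∫ t in (-1 : ℝ)..1, (p * (X ^ (k - j) * (1 - X ^ 2) ^ (j / 2))).eval t)) *
        ((1 - X ^ 2) ^ (j / 2) * X ^ (k - j) : ℝ[X]), ?_, fun x z => ?_⟩
  · refine natDegree_sum_le_of_forall_le _ _ fun k hk => (natDegree_C_mul_le _ _).trans ?_
    refine natDegree_sum_le_of_forall_le _ _ fun j hj => (natDegree_C_mul_le _ _).trans ?_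
    rw [Finset.mem_range, Nat.lt_succ_iff] at hk hj
    exact (natDegree_one_sub_sq_pow_mul_le hj).trans hk
  · have e : ∀ y : S2, p.eval (sdot z y) * q.eval (sdot x y) =
        ∑ k ∈ Finset.range (n + 1), q.coeff k * (p.eval (sdot z y) * sdot x y ^ k) := by
      intro y
      rw [eval_eq_sum_range' (p := q) (Nat.lt_succ_of_le hq), Finset.mul_sum]
      exact Finset.sum_congr rfl fun k _ => by ring
    simp_rw [e]
    rw [integral_finsetSum _ fun j _ => continuous_integrable_S2 (by fun_prop), eval_finsetSum]
    refine Finset.sum_congr rfl fun k _ => ?_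
    rw [integral_const_mul, integral_eval_sdot_mul_sdot_pow, eval_C_mul, eval_finsetSum]
    simp only [eval_C_mul]

theorem continuous_integrable_S2_prod {f : S2 × S2 → ℝ} (hf : Continuous f) :
    Integrable f (sigmaS2.prod sigmaS2) :=
  hf.integrable_of_hasCompactSupport (HasCompactSupport.of_compactSpace f)

/-- Legendre kernels are eigenfunctions of zonal convolution operators. -/
theorem integral_legendreP_sdot_mul_eval (n : ℕ) (p : ℝ[X]) (x z : S2) :
    ∫ y : S2, p.eval (sdot z y) * (legendreP n).eval (sdot x y) ∂sigmaS2 =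
      (halfMass * ∫ t in (-1 : ℝ)..1, p.eval t * (legendreP n).eval t) *
        (legendreP n).eval (sdot z x) := by
  obtain ⟨g, hg, h⟩ := exists_eval_sdot_eq_integral p (legendreP n) (natDegree_legendreP_le n)
  -- The convolution is a polynomial g of degree at most n in `sdot z x`. Fubini moves x^k onto P_n,
  -- so g is orthogonal to lower degrees and hence a multiple of P_n; taking x = z identifies the
  -- factor.
  have horth : ∀ k < n, ∫ t in (-1 : ℝ)..1, g.eval t * t ^ k = 0 := by
    intro k hk
    have h1 := integral_eval_sdot_eq (g * X ^ k) z
    have h2 : ∫ w : S2, (g * X ^ k).eval (sdot z w) ∂sigmaS2 = 0 := by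
      have e : ∀ w : S2, (g * X ^ k).eval (sdot z w) =
          ∫ y : S2, p.eval (sdot z y) * (legendreP n).eval (sdot w y) * sdot z w ^ k ∂sigmaS2 := by
        intro w
        rw [integral_mul_const, h]
        simp
      simp_rw [e]
      rw [integral_integral_swap]
      · refine integral_eq_zero_of_ae (Filter.Eventually.of_forall fun y => ?_)
        have := integral_legendreP_sdot_mul_sdot_pow_eq_zero hk z y
        simp only [mul_assoc, integral_const_mul, Pi.zero_apply]
        simp_rw [sdot_comm y] at this
        rw [this, mul_zero]
      · exact continuous_integrable_S2_prod (by simp only [Function.uncurry_def]; fun_prop)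
    rw [h2] at h1
    have := (mul_eq_zero.mp h1.symm).resolve_left halfMass_pos.ne'
    simpa using this
  have hgP := eq_smul_legendreP hg horth
  have h1 : g.eval 1 = halfMass * ∫ t in (-1 : ℝ)..1, p.eval t * (legendreP n).eval t := by
    have := h z z
    rw [sdot_self] at this
    rw [← this]
    have h2 := integral_eval_sdot_eq (p * legendreP n) z
    simpa using h2
  rw [h, ← h1]
  conv_lhs => rw [hgP]
  simp

/-! ### Integrals along a 4-cycle. -/

theorem legendreKernel_eq (n : ℕ) (x y : S2) :
    legendreKernel n x y = (legendreP n).eval (sdot x y) := by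
  rw [legendreKernel, sphDist, InnerProductGeometry.cos_angle, sdot]
  simp

/-- The integral over `(S²)⁴` of a product of four zonal kernels along a 4-cycle. -/
noncomputable def cycleIntegral (f g h k : ℝ → ℝ) : ℝ :=
  ∫ x : S2 × S2 × S2 × S2, f (sdot x.1 x.2.1) * g (sdot x.2.1 x.2.2.1) *
    h (sdot x.2.2.1 x.2.2.2) * k (sdot x.1 x.2.2.2)
    ∂(sigmaS2.prod (sigmaS2.prod (sigmaS2.prod sigmaS2)))

theorem contractionK_eq_cycleIntegral (n q r : ℕ) :
    contractionK n q r = cycleIntegral (fun t => (legendreP n).eval t ^ r)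
      (fun t => (legendreP n).eval t ^ (q - r)) (fun t => (legendreP n).eval t ^ r)
      (fun t => (legendreP n).eval t ^ (q - r)) := by
  simp only [contractionK, cycleIntegral, legendreKernel_eq]

theorem continuous_integrable_S2_four {f : S2 × S2 × S2 × S2 → ℝ} (hf : Continuous f) :
    Integrable f (sigmaS2.prod (sigmaS2.prod (sigmaS2.prod sigmaS2))) :=
  hf.integrable_of_hasCompactSupport (HasCompactSupport.of_compactSpace f)

theorem continuous_integrable_S2_three {f : S2 × S2 × S2 → ℝ} (hf : Continuous f) :
    Integrable f (sigmaS2.prod (sigmaS2.prod sigmaS2)) :=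
  hf.integrable_of_hasCompactSupport (HasCompactSupport.of_compactSpace f)

theorem integral_S2_four {f : S2 × S2 × S2 × S2 → ℝ} (hf : Continuous f) :
    ∫ x, f x ∂(sigmaS2.prod (sigmaS2.prod (sigmaS2.prod sigmaS2))) =
      ∫ x, ∫ y, ∫ z, ∫ w, f (x, y, z, w) ∂sigmaS2 ∂sigmaS2 ∂sigmaS2 ∂sigmaS2 := by
  rw [integral_prod _ (continuous_integrable_S2_four hf)]
  refine integral_congr_ae (Filter.Eventually.of_forall fun x => ?_)
  simp only []
  rw [integral_prod _ (continuous_integrable_S2_three (by fun_prop))]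
  refine integral_congr_ae (Filter.Eventually.of_forall fun y => ?_)
  simp only []
  rw [integral_prod _ (continuous_integrable_S2_prod (by fun_prop))]

theorem measurePreserving_rotate_S2_four :
    MeasurePreserving (fun x : S2 × S2 × S2 × S2 => (x.2.1, x.2.2.1, x.2.2.2, x.1))
      (sigmaS2.prod (sigmaS2.prod (sigmaS2.prod sigmaS2)))
      (sigmaS2.prod (sigmaS2.prod (sigmaS2.prod sigmaS2))) := by
  have h1 : MeasurePreserving Prod.swap (sigmaS2.prod (sigmaS2.prod (sigmaS2.prod sigmaS2)))
    ((sigmaS2.prod (sigmaS2.prod sigmaS2)).prod sigmaS2) := Measure.measurePreserving_swap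
  have h2 := measurePreserving_prodAssoc sigmaS2 (sigmaS2.prod sigmaS2) sigmaS2
  have h3 := (MeasurePreserving.id sigmaS2).prod
    (measurePreserving_prodAssoc sigmaS2 sigmaS2 sigmaS2)
  exact h3.comp (h2.comp h1)

/-- Cyclic relabelling of the four points; it is the source of the symmetry r ↔ q - r. -/
theorem cycleIntegral_rotate {f g h k : ℝ → ℝ} (hf : Continuous f) (hg : Continuous g)
    (hh : Continuous h) (hk : Continuous k) :
    cycleIntegral f g h k = cycleIntegral g h k f := by
  have hT := measurePreserving_rotate_S2_four
  rw [cycleIntegral, cycleIntegral]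
  conv_rhs => rw [← hT.map_eq]
  rw [integral_map hT.aemeasurable (Continuous.aestronglyMeasurable (by fun_prop))]
  refine integral_congr_ae (Filter.Eventually.of_forall fun x => ?_)
  simp only []
  rw [sdot_comm x.2.2.2 x.1, sdot_comm x.2.1 x.1]
  ring

theorem contractionK_symm {n q r : ℕ} (hr : r ≤ q) :
    contractionK n q r = contractionK n q (q - r) := by
  rw [contractionK_eq_cycleIntegral, contractionK_eq_cycleIntegral,
    cycleIntegral_rotate (by fun_prop) (by fun_prop) (by fun_prop) (by fun_prop),
    Nat.sub_sub_self hr]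

/-- The integral of a zonal function over the sphere. -/
noncomputable def zonalMean (f : ℝ → ℝ) : ℝ := halfMass * ∫ t in (-1 : ℝ)..1, f t

theorem integral_S2_const (c : ℝ) : ∫ _ : S2, c ∂sigmaS2 = 2 * halfMass * c := by
  rw [integral_const, smul_eq_mul, halfMass]; ring

/-- Removing an edge leaves a path, which is integrated vertex by vertex from its free end. -/
theorem cycleIntegral_one {f g h : ℝ → ℝ} (hf : Continuous f) (hg : Continuous g)
    (hh : Continuous h) : cycleIntegral f g h (fun _ => 1) =
      2 * halfMass * (zonalMean f * zonalMean g * zonalMean h) := by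
  rw [cycleIntegral, integral_S2_four (by fun_prop)]
  simp only [mul_one, integral_const_mul]
  simp_rw [integral_comp_sdot hh]
  simp only [integral_mul_const, integral_const_mul]
  simp_rw [integral_comp_sdot hg]
  simp only [integral_mul_const]
  simp_rw [integral_comp_sdot hf]
  simp only [integral_mul_const, integral_S2_const, zonalMean]
  ring

theorem abs_cycleIntegral_le {f g h k f' g' h' k' : ℝ → ℝ} (hf' : Continuous f')
    (hg' : Continuous g') (hh' : Continuous h') (hk' : Continuous k')
    (hff : ∀ t ∈ Set.Icc (-1 : ℝ) 1, |f t| ≤ f' t) (hgg : ∀ t ∈ Set.Icc (-1 : ℝ) 1, |g t| ≤ g' t)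
    (hhh : ∀ t ∈ Set.Icc (-1 : ℝ) 1, |h t| ≤ h' t)
    (hkk : ∀ t ∈ Set.Icc (-1 : ℝ) 1, |k t| ≤ k' t) :
    |cycleIntegral f g h k| ≤ cycleIntegral f' g' h' k' := by
  rw [cycleIntegral, cycleIntegral, ← Real.norm_eq_abs]
  refine norm_integral_le_of_norm_le (continuous_integrable_S2_four (by fun_prop))
    (Filter.Eventually.of_forall fun x => ?_)
  simp only [Real.norm_eq_abs, abs_mul]
  have a := hff _ (sdot_mem_Icc x.1 x.2.1)
  have b := hgg _ (sdot_mem_Icc x.2.1 x.2.2.1)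
  have c := hhh _ (sdot_mem_Icc x.2.2.1 x.2.2.2)
  have d := hkk _ (sdot_mem_Icc x.1 x.2.2.2)
  have a0 := (abs_nonneg _).trans a
  have b0 := (abs_nonneg _).trans b
  have c0 := (abs_nonneg _).trans c
  gcongr

/-- From 2ab ≤ a² + b² on the two opposite f-edges: each resulting term has lost one edge and is a
path integral. -/
theorem cycleIntegral_le_of_alternating {f g : ℝ → ℝ} (hf : Continuous f) (hg : Continuous g)
    (hg0 : ∀ t, 0 ≤ g t) :
    cycleIntegral f g f g ≤
      2 * halfMass * (zonalMean (fun t => f t ^ 2) * zonalMean g ^ 2) := by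
  have hc : Continuous fun _ : ℝ => (1 : ℝ) := continuous_const
  have hf2 : Continuous fun t => f t ^ 2 := hf.pow 2
  have e2 : cycleIntegral (fun _ => 1) g (fun t => f t ^ 2) g =
      cycleIntegral g (fun t => f t ^ 2) g (fun _ => 1) :=
    cycleIntegral_rotate hc hg hf2 hg
  have e1 : cycleIntegral (fun t => f t ^ 2) g (fun _ => 1) g =
      cycleIntegral g (fun t => f t ^ 2) g (fun _ => 1) := by
    rw [cycleIntegral_rotate hf2 hg hc hg, cycleIntegral_rotate hg hc hg hf2, e2]
  have hle : cycleIntegral f g f g ≤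
      1 / 2 * (cycleIntegral (fun t => f t ^ 2) g (fun _ => 1) g +
        cycleIntegral (fun _ => 1) g (fun t => f t ^ 2) g) := by
    simp only [cycleIntegral]
    rw [← integral_add (continuous_integrable_S2_four (by fun_prop))
      (continuous_integrable_S2_four (by fun_prop)), ← integral_const_mul]
    refine integral_mono (continuous_integrable_S2_four (by fun_prop))
      (continuous_integrable_S2_four (by fun_prop)) fun x => ?_
    simp only []
    have h1 := mul_nonneg (hg0 (sdot x.2.1 x.2.2.1)) (hg0 (sdot x.1 x.2.2.2))
    nlinarith [mul_nonneg h1 (sq_nonneg (f (sdot x.1 x.2.1) - f (sdot x.2.2.1 x.2.2.2)))]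
  rw [e1, e2, cycleIntegral_one hg hf2 hg] at hle
  refine hle.trans (le_of_eq ?_)
  simp only [zonalMean]
  ring

/-- AM-GM: the left side is the geometric mean of the four products that omit one variable. -/
theorem mul_cube_le_of_four (a b c d : ℝ) :
    a ^ 3 * b ^ 3 * c ^ 3 * d ^ 3 ≤ 1 / 4 * ((a ^ 4 * b ^ 4 * c ^ 4 + b ^ 4 * c ^ 4 * d ^ 4) +
      (a ^ 4 * c ^ 4 * d ^ 4 + a ^ 4 * b ^ 4 * d ^ 4)) := by
  nlinarith [sq_nonneg ((a * b * c) ^ 2 - (b * c * d) ^ 2),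
    sq_nonneg ((a * c * d) ^ 2 - (a * b * d) ^ 2),
    sq_nonneg (a * b * c * (b * c * d) - a * c * d * (a * b * d))]

theorem cycleIntegral_cube_le {f : ℝ → ℝ} (hf : Continuous f) :
    cycleIntegral (fun t => f t ^ 3) (fun t => f t ^ 3) (fun t => f t ^ 3) (fun t => f t ^ 3) ≤
      2 * halfMass * zonalMean (fun t => f t ^ 4) ^ 3 := by
  have hc : Continuous fun _ : ℝ => (1 : ℝ) := continuous_const
  have h4 : Continuous fun t => f t ^ 4 := hf.pow 4
  set F := fun t => f t ^ 4 with hF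
  have e1 : cycleIntegral (fun _ => 1) F F F = cycleIntegral F F F (fun _ => 1) :=
    cycleIntegral_rotate hc h4 h4 h4
  have e2 : cycleIntegral F (fun _ => 1) F F = cycleIntegral F F F (fun _ => 1) := by
    rw [cycleIntegral_rotate h4 hc h4 h4, e1]
  have e3 : cycleIntegral F F (fun _ => 1) F = cycleIntegral F F F (fun _ => 1) := by
    rw [cycleIntegral_rotate h4 h4 hc h4, e2]
  have hle : cycleIntegral (fun t => f t ^ 3) (fun t => f t ^ 3) (fun t => f t ^ 3)
      (fun t => f t ^ 3) ≤ 1 / 4 * ((cycleIntegral F F F (fun _ => 1) +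
        cycleIntegral (fun _ => 1) F F F) + (cycleIntegral F (fun _ => 1) F F +
        cycleIntegral F F (fun _ => 1) F)) := by
    simp only [cycleIntegral]
    rw [← integral_add (continuous_integrable_S2_four (by fun_prop))
      (continuous_integrable_S2_four (by fun_prop)),
      ← integral_add (continuous_integrable_S2_four (by fun_prop))
      (continuous_integrable_S2_four (by fun_prop)),
      ← integral_add (continuous_integrable_S2_four (by fun_prop))
      (continuous_integrable_S2_four (by fun_prop)), ← integral_const_mul]
    refine integral_mono (continuous_integrable_S2_four (by fun_prop))
      (continuous_integrable_S2_four (by fun_prop)) fun x => ?_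
    simp only [hF, one_mul, mul_one]
    exact mul_cube_le_of_four _ _ _ _
  rw [e1, e2, e3, cycleIntegral_one h4 h4 h4] at hle
  refine hle.trans (le_of_eq ?_)
  ring

/-- Integrating out the fourth and then the third point convolves P_n with P_n^(q-1) twice; each
time the eigenvalue `zonalMean` of P_n^q comes out, and P_n(x₁·x₂)² is left. -/
theorem contractionK_one_eq (n : ℕ) {q : ℕ} (hq : 1 ≤ q) :
    contractionK n q 1 = 2 * halfMass * (zonalMean (fun t => (legendreP n).eval t ^ q) ^ 2 *
      zonalMean (fun t => (legendreP n).eval t ^ 2)) := by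
  have hrep : ∀ x z : S2, ∫ y : S2, (legendreP n).eval (sdot z y) ^ (q - 1) *
      (legendreP n).eval (sdot x y) ∂sigmaS2 =
      zonalMean (fun t => (legendreP n).eval t ^ q) * (legendreP n).eval (sdot z x) := by
    intro x z
    have h := integral_legendreP_sdot_mul_eval n (legendreP n ^ (q - 1)) x z
    simp only [eval_pow] at h
    rw [h, zonalMean]
    congr 3
    funext t
    rw [← pow_succ, Nat.sub_add_cancel hq]
  set lam := zonalMean (fun t => (legendreP n).eval t ^ q)
  have hM : ∀ x : S2, ∫ y : S2, (legendreP n).eval (sdot x y) * (legendreP n).eval (sdot x y)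
      ∂sigmaS2 = zonalMean (fun t => (legendreP n).eval t ^ 2) := by
    intro x
    have := integral_comp_sdot (f := fun t => (legendreP n).eval t ^ 2) (by fun_prop) x
    simp only [sq] at this ⊢
    exact this
  rw [contractionK_eq_cycleIntegral, cycleIntegral, integral_S2_four (by fun_prop)]
  simp only [pow_one]
  have h4 : ∀ x y z : S2, ∫ w : S2, (legendreP n).eval (sdot x y) *
      (legendreP n).eval (sdot y z) ^ (q - 1) * (legendreP n).eval (sdot z w) *
      (legendreP n).eval (sdot x w) ^ (q - 1) ∂sigmaS2 =
      lam * (legendreP n).eval (sdot x y) *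
        ((legendreP n).eval (sdot y z) ^ (q - 1) * (legendreP n).eval (sdot x z)) := by
    intro x y z
    rw [show lam * (legendreP n).eval (sdot x y) *
        ((legendreP n).eval (sdot y z) ^ (q - 1) * (legendreP n).eval (sdot x z)) =
        ((legendreP n).eval (sdot x y) * (legendreP n).eval (sdot y z) ^ (q - 1)) *
          (lam * (legendreP n).eval (sdot x z)) by ring, ← hrep z x, ← integral_const_mul]
    congr 1; funext w; ring
  simp_rw [h4, integral_const_mul, hrep]
  have h2 : ∀ x y : S2, lam * (legendreP n).eval (sdot x y) *
      (lam * (legendreP n).eval (sdot y x)) =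
      lam ^ 2 * ((legendreP n).eval (sdot x y) * (legendreP n).eval (sdot x y)) := by
    intro x y; rw [sdot_comm y x]; ring
  simp_rw [h2, integral_const_mul, hM, integral_S2_const]
  ring

/-! ### Decay rates of the contraction integrals. -/

theorem abs_zonalMean_le {p : ℝ} (hp : 0 ≤ p) (hp4 : p < 4) :
    ∃ C : ℝ, 0 ≤ C ∧ ∀ n : ℕ, 1 ≤ n → ∀ f : ℝ → ℝ,
      (∀ t ∈ Set.Icc (-1 : ℝ) 1, |f t| ≤ |(legendreP n).eval t| ^ p) →
      |zonalMean f| ≤ C * (n : ℝ) ^ (-(p / 2)) := by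
  obtain ⟨C, hC, h⟩ := integral_abs_legendreP_rpow_le hp hp4
  refine ⟨halfMass * C, mul_nonneg halfMass_pos.le hC, fun n hn f hf => ?_⟩
  rw [zonalMean, abs_mul, abs_of_pos halfMass_pos, mul_assoc]
  refine mul_le_mul_of_nonneg_left (le_trans ?_ (h n hn)) halfMass_pos.le
  rw [← Real.norm_eq_abs]
  have hcont : Continuous fun x : ℝ => |(legendreP n).eval x| ^ p :=
    ((legendreP n).continuous.abs).rpow_const fun x => Or.inr hp
  refine intervalIntegral.norm_integral_le_of_norm_le (by norm_num)
    (Filter.Eventually.of_forall fun t ht => ?_) (hcont.intervalIntegrable _ _)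
  exact hf t ⟨ht.1.le, ht.2⟩

theorem abs_legendreP_pow_le_rpow {n : ℕ} (hn : 1 ≤ n) {p : ℝ} {m : ℕ} (hm : p ≤ m) (hp : 0 ≤ p)
    {t : ℝ} (ht : t ∈ Set.Icc (-1 : ℝ) 1) :
    |(legendreP n).eval t| ^ m ≤ |(legendreP n).eval t| ^ p := by
  rw [← Real.rpow_natCast]
  rcases (abs_nonneg ((legendreP n).eval t)).eq_or_lt with h | h
  · rw [← h]
    rcases hp.eq_or_lt with rfl | hp'
    · rw [Real.rpow_zero]; exact Real.rpow_le_one le_rfl zero_le_one (by positivity)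
    · rw [Real.zero_rpow hp'.ne', Real.zero_rpow (by linarith)]
  · exact Real.rpow_le_rpow_of_exponent_ge h (abs_legendreP_le_one hn ht) hm

/-- Since |P_n| ≤ 1 on [-1, 1], the exponents r and q - r may be lowered to 2 and m, which removes q
and r from the bound. -/
theorem abs_contractionK_le_of_two_le {n q r m : ℕ} (hn : 1 ≤ n) (hr : 2 ≤ r) (hm : m ≤ q - r) :
    |contractionK n q r| ≤ 2 * halfMass *
      (zonalMean (fun t => |(legendreP n).eval t| ^ 4) *
        zonalMean (fun t => |(legendreP n).eval t| ^ m) ^ 2) := by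
  have h := cycleIntegral_le_of_alternating (f := fun t => |(legendreP n).eval t| ^ 2)
    (g := fun t => |(legendreP n).eval t| ^ m) (by fun_prop) (by fun_prop)
    (fun t => by positivity)
  simp only [← pow_mul] at h
  refine le_trans ?_ h
  rw [contractionK_eq_cycleIntegral]
  have hpow : ∀ {a b : ℕ}, a ≤ b → ∀ t ∈ Set.Icc (-1 : ℝ) 1,
      |(legendreP n).eval t ^ b| ≤ |(legendreP n).eval t| ^ a := fun hab t ht => by
    rw [abs_pow]
    exact pow_le_pow_of_le_one (abs_nonneg _) (abs_legendreP_le_one hn ht) hab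
  exact abs_cycleIntegral_le (by fun_prop) (by fun_prop) (by fun_prop) (by fun_prop)
    (hpow hr) (hpow hm) (hpow hr) (hpow hm)

/-- Opening the cycle on opposite edges would involve ∫P_n⁴, the critical exponent. Writing |P|² as
(|P|^(2/3))³ spreads the loss over all edges and needs only the exponent 8/3 < 4. -/
theorem abs_contractionK_four_two_le (n : ℕ) :
    |contractionK n 4 2| ≤ 2 * halfMass *
      zonalMean (fun t => (|(legendreP n).eval t| ^ (2 / 3 : ℝ)) ^ 4) ^ 3 := by
  have hcont : Continuous fun x : ℝ => |(legendreP n).eval x| ^ (2 / 3 : ℝ) :=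
    ((legendreP n).continuous.abs).rpow_const fun x => Or.inr (by norm_num)
  refine le_trans ?_ (cycleIntegral_cube_le hcont)
  rw [contractionK_eq_cycleIntegral]
  have key : ∀ t ∈ Set.Icc (-1 : ℝ) 1, |(legendreP n).eval t ^ 2| ≤
      (|(legendreP n).eval t| ^ (2 / 3 : ℝ)) ^ 3 := fun t _ => by
    rw [abs_pow, ← Real.rpow_mul_natCast (abs_nonneg _)]
    norm_num
  exact abs_cycleIntegral_le (hcont.pow 3) (hcont.pow 3) (hcont.pow 3) (hcont.pow 3)
    key key key key

theorem abs_contractionK_three_one_le :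
    ∃ D : ℝ, 0 ≤ D ∧ ∀ n : ℕ, 1 ≤ n → |contractionK n 3 1| ≤ D * (1 / (n : ℝ) ^ 5) := by
  obtain ⟨C, hC, h⟩ := abs_zonalMean_le (p := 2) (by norm_num) (by norm_num)
  have hA := halfMass_pos
  refine ⟨2 * halfMass * ((halfMass * 800) ^ 2 * C), by positivity, fun n hn => ?_⟩
  have hn' : (1 : ℝ) ≤ n := by exact_mod_cast hn
  have h2 := h n hn (fun t => (legendreP n).eval t ^ 2) (fun t _ => by simp)
  have h3 : |zonalMean (fun t => (legendreP n).eval t ^ 3)| ≤ halfMass * (800 / n ^ 2) := by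
    rw [zonalMean, abs_mul, abs_of_pos hA]
    exact mul_le_mul_of_nonneg_left (abs_integral_legendreP_cube_le hn) hA.le
  rw [contractionK_one_eq n (by norm_num),
    abs_mul (2 * halfMass), abs_of_pos (by positivity : 0 < 2 * halfMass), abs_mul, abs_pow]
  calc _ ≤ 2 * halfMass * ((halfMass * (800 / n ^ 2)) ^ 2 * (C * (n : ℝ) ^ (-(2 / 2 : ℝ)))) := by
        gcongr
    _ = _ := by
        rw [show -(2 / 2 : ℝ) = -1 by norm_num, Real.rpow_neg_one]
        field_simp

theorem abs_contractionK_one_le :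
    ∃ D : ℝ, 0 ≤ D ∧ ∀ q : ℕ, 4 ≤ q → ∀ n : ℕ, 1 ≤ n →
      |contractionK n q 1| ≤ D * (n : ℝ) ^ (-(9 / 2) : ℝ) := by
  obtain ⟨C, hC, h⟩ := abs_zonalMean_le (p := 2) (by norm_num) (by norm_num)
  -- The exponent 7/2 gives (n^(-7/4))² · n^(-1) = n^(-9/2), exactly the target rate.
  obtain ⟨C', hC', h'⟩ := abs_zonalMean_le (p := 7 / 2) (by norm_num) (by norm_num)
  have hA := halfMass_pos
  refine ⟨2 * halfMass * (C' ^ 2 * C), by positivity, fun q hq n hn => ?_⟩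
  have hn' : (1 : ℝ) ≤ n := by exact_mod_cast hn
  have h2 := h n hn (fun t => (legendreP n).eval t ^ 2) (fun t _ => by simp)
  have h3 := h' n hn (fun t => (legendreP n).eval t ^ q) (fun t ht => by
    rw [abs_pow]
    refine abs_legendreP_pow_le_rpow hn ?_ (by norm_num) ht
    have : (4 : ℝ) ≤ q := by exact_mod_cast hq
    linarith)
  rw [contractionK_one_eq n (by omega),
    abs_mul (2 * halfMass), abs_of_pos (by positivity : 0 < 2 * halfMass), abs_mul, abs_pow]
  calc _ ≤ 2 * halfMass * ((C' * (n : ℝ) ^ (-(7 / 2 / 2) : ℝ)) ^ 2 *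
        (C * (n : ℝ) ^ (-(2 / 2 : ℝ)))) := by gcongr
    _ = 2 * halfMass * (C' ^ 2 * C) *
        (((n : ℝ) ^ (-(7 / 2 / 2) : ℝ)) ^ 2 * (n : ℝ) ^ (-(2 / 2 : ℝ))) := by ring
    _ = _ := by
        rw [← Real.rpow_mul_natCast (by positivity), ← Real.rpow_add (by positivity)]
        norm_num

theorem abs_contractionK_four_two_isBigO :
    ∃ D : ℝ, 0 ≤ D ∧ ∀ n : ℕ, 1 ≤ n → |contractionK n 4 2| ≤ D * (n : ℝ) ^ (-4 : ℝ) := by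
  obtain ⟨C, hC, h⟩ := abs_zonalMean_le (p := 8 / 3) (by norm_num) (by norm_num)
  have hA := halfMass_pos
  refine ⟨2 * halfMass * C ^ 3, by positivity, fun n hn => ?_⟩
  have hn' : (1 : ℝ) ≤ n := by exact_mod_cast hn
  have h2 := h n hn (fun t => (|(legendreP n).eval t| ^ (2 / 3 : ℝ)) ^ 4) (fun t _ => by
    rw [abs_of_nonneg (by positivity), ← Real.rpow_mul_natCast (abs_nonneg _)]
    norm_num)
  refine (abs_contractionK_four_two_le n).trans ?_
  calc _ ≤ 2 * halfMass * (C * (n : ℝ) ^ (-(8 / 3 / 2) : ℝ)) ^ 3 := by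
        refine mul_le_mul_of_nonneg_left ?_ (by positivity)
        refine (le_abs_self _).trans ?_
        rw [abs_pow]
        gcongr
    _ = 2 * halfMass * C ^ 3 * ((n : ℝ) ^ (-(8 / 3 / 2) : ℝ)) ^ 3 := by ring
    _ = _ := by
        rw [← Real.rpow_mul_natCast (by positivity)]
        norm_num

theorem abs_contractionK_isBigO_of_two_le {m : ℕ} {p : ℝ} (hp : 0 ≤ p) (hp4 : p < 4)
    (hpm : p ≤ m) :
    ∃ D : ℝ, 0 ≤ D ∧ ∀ n : ℕ, 1 ≤ n → ∀ q r : ℕ, 2 ≤ r → m ≤ q - r →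
      |contractionK n q r| ≤ D * (n : ℝ) ^ (-(7 / 4 + p) : ℝ) := by
  obtain ⟨C, hC, h⟩ := abs_zonalMean_le hp hp4
  obtain ⟨C', hC', h'⟩ := abs_zonalMean_le (p := 7 / 2) (by norm_num) (by norm_num)
  have hA := halfMass_pos
  refine ⟨2 * halfMass * (C' * C ^ 2), by positivity, fun n hn q r hr hm => ?_⟩
  have hn' : (1 : ℝ) ≤ n := by exact_mod_cast hn
  have h2 := h n hn (fun t => |(legendreP n).eval t| ^ m) (fun t ht => by
    rw [abs_of_nonneg (by positivity)]; exact abs_legendreP_pow_le_rpow hn hpm hp ht)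
  have h3 := h' n hn (fun t => |(legendreP n).eval t| ^ 4) (fun t ht => by
    rw [abs_of_nonneg (by positivity)]
    exact abs_legendreP_pow_le_rpow hn (by norm_num) (by norm_num) ht)
  refine (abs_contractionK_le_of_two_le hn hr hm).trans ?_
  calc _ ≤ 2 * halfMass * (C' * (n : ℝ) ^ (-(7 / 2 / 2) : ℝ) *
        (C * (n : ℝ) ^ (-(p / 2))) ^ 2) := by
        refine mul_le_mul_of_nonneg_left ?_ (by positivity)
        refine (le_abs_self _).trans ?_
        rw [abs_mul, abs_pow]
        gcongr
    _ = 2 * halfMass * (C' * C ^ 2) * ((n : ℝ) ^ (-(7 / 2 / 2) : ℝ) *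
        ((n : ℝ) ^ (-(p / 2))) ^ 2) := by ring
    _ = _ := by
        rw [← Real.rpow_mul_natCast (by positivity), ← Real.rpow_add (by positivity)]
        congr 2
        push_cast
        ring

end LegendreBounds

/-! ### Assembly of the four cases. -/

theorem proposition3 :
    ∃ C : ℝ,
      -- `q = 3`
      (∀ r : ℕ, 1 ≤ r → r ≤ 2 → ∀ ℓ : ℕ, 1 ≤ ℓ →
        |contractionK ℓ 3 r| ≤ C * (1 / (ℓ : ℝ) ^ 5)) ∧
      -- `q = 4`
      (∀ r : ℕ, 1 ≤ r → r ≤ 3 → ∀ ℓ : ℕ, 1 ≤ ℓ →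
        |contractionK ℓ 4 r| ≤ C * (1 / (ℓ : ℝ) ^ 4)) ∧
      -- `q = 5, 6`
      (∀ q : ℕ, q = 5 ∨ q = 6 → ∀ r : ℕ, 1 ≤ r → r ≤ q - 1 → ∀ ℓ : ℕ, 2 ≤ ℓ →
        |contractionK ℓ q r| ≤ C * (Real.log (ℓ : ℝ) / (ℓ : ℝ) ^ ((9 : ℝ) / 2))) ∧
      -- `q ≥ 7`
      (∀ q : ℕ, 7 ≤ q →
        (∀ ℓ : ℕ, 1 ≤ ℓ →
          contractionK ℓ q 1 = contractionK ℓ q (q - 1) ∧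
          |contractionK ℓ q 1| ≤ C * (1 / (ℓ : ℝ) ^ ((9 : ℝ) / 2))) ∧
        (∀ r : ℕ, 2 ≤ r → r ≤ q - 2 → ∀ ℓ : ℕ, 1 ≤ ℓ →
          |contractionK ℓ q r| ≤ C * (1 / (ℓ : ℝ) ^ 5))) := by
  obtain ⟨D0, hD0, h0⟩ := abs_contractionK_three_one_le
  obtain ⟨D1, hD1, h1⟩ := abs_contractionK_one_le
  obtain ⟨D2, hD2, h2⟩ := abs_contractionK_four_two_isBigO
  -- The rates 7/4 + p are 19/4 ≥ 9/2 for m = 3 and 21/4 ≥ 5 for m = 4.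
  obtain ⟨D3, hD3, h3⟩ := abs_contractionK_isBigO_of_two_le (m := 3) (p := 3)
    (by norm_num) (by norm_num) (by norm_num)
  obtain ⟨D4, hD4, h4⟩ := abs_contractionK_isBigO_of_two_le (m := 4) (p := 7 / 2)
    (by norm_num) (by norm_num) (by norm_num)
  have hlog2 : 0 < Real.log 2 := Real.log_pos one_lt_two
  have hD5 : 0 ≤ (D1 + D3) / Real.log 2 := by positivity
  -- For q = 5, 6 the bounds carry no logarithm; log ℓ ≥ log 2 for ℓ ≥ 2 inserts it.
  set D5 := (D1 + D3) / Real.log 2 with hD5_def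
  have hrpow : ∀ {D E a b : ℝ} {n : ℕ}, 1 ≤ n → 0 ≤ D → D ≤ E → b ≤ a →
      D * (n : ℝ) ^ (-a) ≤ E * (1 / (n : ℝ) ^ b) := by
    intro D E a b n hn hD hDE hab
    have hn' : (1 : ℝ) ≤ n := by exact_mod_cast hn
    rw [one_div, ← Real.rpow_neg (by positivity)]
    exact mul_le_mul hDE (Real.rpow_le_rpow_of_exponent_le hn' (neg_le_neg hab)) (by positivity)
      (hD.trans hDE)
  have hpow4 : ∀ n : ℕ, (n : ℝ) ^ 4 = (n : ℝ) ^ (4 : ℝ) := fun n => by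
    rw [← Real.rpow_natCast]; norm_num
  have hpow5 : ∀ n : ℕ, (n : ℝ) ^ 5 = (n : ℝ) ^ (5 : ℝ) := fun n => by
    rw [← Real.rpow_natCast]; norm_num
  have hlog : ∀ {D a : ℝ} {n : ℕ}, 2 ≤ n → 0 ≤ D → D ≤ D1 + D3 → 9 / 2 ≤ a →
      D * (n : ℝ) ^ (-a) ≤ (D0 + D1 + D2 + D4 + D5) * (Real.log n / (n : ℝ) ^ ((9 : ℝ) / 2)) := by
    intro D a n hn hD hDE ha
    have hn' : (2 : ℝ) ≤ n := by exact_mod_cast hn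
    have hl : Real.log 2 ≤ Real.log n := Real.log_le_log two_pos hn'
    refine (hrpow (by omega) hD hDE ha).trans ?_
    rw [mul_one_div, mul_div_assoc']
    refine div_le_div_of_nonneg_right ?_ (by positivity)
    calc D1 + D3 = D5 * Real.log 2 := by rw [hD5_def]; field_simp
      _ ≤ (D0 + D1 + D2 + D4 + D5) * Real.log n :=
        mul_le_mul (by linarith) hl hlog2.le (by positivity)
  refine ⟨D0 + D1 + D2 + D4 + D5, ?_, ?_, ?_, ?_⟩
  · intro r hr1 hr2 n hn
    have key : |contractionK n 3 1| ≤ (D0 + D1 + D2 + D4 + D5) * (1 / (n : ℝ) ^ 5) :=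
      (h0 n hn).trans (mul_le_mul_of_nonneg_right (by linarith) (by positivity))
    interval_cases r
    · exact key
    · rw [contractionK_symm (by norm_num)]; exact key
  · intro r hr1 hr3 n hn
    rw [hpow4]
    have key := (h1 4 le_rfl n hn).trans
      (hrpow (E := D0 + D1 + D2 + D4 + D5) (b := 4) hn hD1 (by linarith) (by norm_num))
    interval_cases r
    · exact key
    · exact (h2 n hn).trans (hrpow hn hD2 (by linarith) le_rfl)
    · rw [contractionK_symm (by norm_num)]; exact key
  · intro q hq r hr1 hrq n hn
    have hq5 : 5 ≤ q := by omega
    have key : ∀ s : ℕ, 1 ≤ s → 3 ≤ q - s → |contractionK n q s| ≤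
        (D0 + D1 + D2 + D4 + D5) * (Real.log n / (n : ℝ) ^ ((9 : ℝ) / 2)) := by
      intro s hs hqs
      rcases hs.eq_or_lt with rfl | hs
      · exact (h1 q (by omega) n (by omega)).trans (hlog hn hD1 (by linarith) le_rfl)
      · exact (h3 n (by omega) q s hs hqs).trans (hlog hn hD3 (by linarith) (by norm_num))
    -- As q ≥ 5, at least one of r and q - r is ≥ 3; symmetry makes it the second exponent.
    by_cases h : 3 ≤ q - r
    · exact key r hr1 h
    · rw [contractionK_symm (by omega)]
      exact key (q - r) (by omega) (by omega)
  · intro q hq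
    refine ⟨fun n hn => ⟨contractionK_symm (by omega), ?_⟩, fun r hr hrq n hn => ?_⟩
    · exact (h1 q (by omega) n hn).trans (hrpow hn hD1 (by linarith) le_rfl)
    · have key : ∀ s : ℕ, 2 ≤ s → 4 ≤ q - s → |contractionK n q s| ≤
          (D0 + D1 + D2 + D4 + D5) * (1 / (n : ℝ) ^ 5) := by
        intro s hs hqs
        rw [hpow5]
        exact (h4 n hn q s hs hqs).trans (hrpow hn hD4 (by linarith) (by norm_num))
      -- As q ≥ 7, at least one of r and q - r is ≥ 4.
      by_cases h : 4 ≤ q - r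
      · exact key r hr h
      · rw [contractionK_symm (by omega)]
        exact key (q - r) (by omega) (by omega)
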